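/- Throughout, algebraic sets are real: a subset $V\subset\mathbb{R}^N$ is *algebraic* (resp. *$\mathbb{Q}$-algebraic*) if it is the zero set of a family of polynomials in $\mathbb{R}[x_1,\dots,x_N]$ (resp. in $\mathbb{Q}[x_1,\dots,x_N]$). Let $\mathcal{I}(V)\subset\mathbb{R}[x]$ be the ideal of polynomials vanishing on $V$; $\dim V$ is the Krull dimension of $\mathbb{R}[x]/\mathcal{I}(V)$, and $V$ is *nonsingular* if for every $a\in V$ the ring $\mathbb{R}[x]_{\mathfrak{n}_a}/\mathcal{I}(V)\mathbb{R}[x]_{\mathfrak{n}_a}$, where $\mathfrak{n}_a$ is the maximal ideal of polynomials vanishing at $a$, is a regular local ring of dimension $\dim V$. A regular map $V'\to V$ is *birational* if it restricts to a biregular isomorphism between a Zariski open dense subset of $V'$ and a Zariski open dense subset of $V$. If $V\subset\mathbb{R}^p$ is a $\mathbb{Q}$-algebraic set, a *desingularization* of $V$ is a nonsingular algebraic set $V'\subset\mathbb{R}^p\times\mathbb{R}^q$, for some $q$, with $\dim V'=\dim V$, such that the projection $\mathbb{R}^p\times\mathbb{R}^q\to\mathbb{R}^p$ restricts to a birational map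 $V'\to V$. Let $m,n\ge 1$. For $0\le k\le m+n$ let $\mathbb{G}_{k,m+n-k}=\{X\in\mathbb{R}^{(m+n)^2}: X^T=X,\ X^2=X,\ \mathrm{tr}(X)=k\}$ be the embedded Grassmannian of $k$-dimensional subspaces of $\mathbb{R}^{m+n}$ (a subspace corresponds to the matrix of the orthogonal projection onto it, and is the image of that matrix). For $0\le\ell\le m+n$ let $\mathbb{R}^\ell\subset\mathbb{R}^{m+n}$ be the span of the first $\ell$ vectors of the canonical basis, and let $D_\ell$ be the diagonal matrix of size $m+n$ with $1$ in the first $\ell$ diagonal positions and $0$ otherwise. Let $\lambda=(\lambda_1,\dots,\lambda_m)$ be a partition with $n\ge\lambda_1\ge\dots\ge\lambda_m\ge 0$, and let $$\sigma_\lambda=\{X\in\mathbb{G}_{m,n}:\ \dim(\mathrm{im}(X)\cap\mathbb{R}^{n+k-\lambda_k})\ge k\ \text{ for } k=1,\dots,m\}$$ be the associated Schubert variety. Let $c\ge1$, $a_1,\dots,a_{c-1},b_1,\dots,b_{c-1}\geq 1$ and $a_c,b_0\ge0$ be the integers, uniquely determined by $\lambda$, such that $a_1+\dots+a_c=m$,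 $b_0+\dots+b_{c-1}=n$, and $\lambda_j=\sum_{k=i}^{c-1}b_k$ whenever $1\le i\le c$ and $a_1+\dots+a_{i-1}<j\le a_1+\dots+a_i$. Put $m_k=\sum_{i=1}^k a_i$, $n_k=m+n-m_k$ and $d_k=m_k+\sum_{i=1}^k b_{i-1}$ for $k=1,\dots,c$. **Lemma.** If $a_c>0$ and $b_0>0$, then the embedded Bott–Samelson set $$Z_\lambda=\left\{(X,Y_{c-1},\dots,Y_1)\in\mathbb{G}_{m,n}\times\mathbb{G}_{m_{c-1},n_{c-1}}\times\dots\times\mathbb{G}_{m_1,n_1}:\ \begin{array}{l}Y_iD_{d_i}=Y_i\ (1\le i\le c-1),\\ Y_{i+1}Y_i=Y_i\ (1\le i\le c-2),\\ XY_{c-1}=Y_{c-1}\end{array}\right\}$$ (where the last condition is void for $c=1$) is a desingularization of $\sigma_\lambda$. That is, $\sigma_\lambda$ is a $\mathbb{Q}$-algebraic set, $Z_\lambda\subset\mathbb{R}^{(m+n)^2c}$ is a nonsingular algebraic set of dimension $\dim\sigma_\lambda$, and the projection $(X,Y_{c-1},\dots,Y_1)\mapsto X$ restricts to a birational map $Z_\lambda\to\sigma_\lambda$.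 -/

import Mathlib

/-! Real algebraic sets in affine spaces `σ → L`, where `σ` is a finite index set of coordinates. -/

namespace RealAlg

/-- `V ⊆ L^σ` is a `K`-algebraic set: the set of common zeros in `L^σ` of a family of polynomials
with coefficients in the subfield `K`. -/
def IsAlgebraicSet (K : Type*) {L σ : Type*} [Field K] [Field L] [Algebra K L]
    (V : Set (σ → L)) : Prop :=
  ∃ F : Set (MvPolynomial σ K), V = {x | ∀ f ∈ F, MvPolynomial.aeval x f = 0}

/-- The dimension of `V ⊆ ℝ^σ`: the Krull dimension of `ℝ[x] / I(V)`, where `I(V)` is the ideal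
of the real polynomials vanishing on `V`. -/
noncomputable def dim {σ : Type*} (V : Set (σ → ℝ)) : WithBot ℕ∞ :=
  ringKrullDim (MvPolynomial σ ℝ ⧸ MvPolynomial.vanishingIdeal ℝ V)

/-- The local ring `ℝ[x]_{𝔫_a}` of `ℝ^σ` at `a`, where `𝔫_a` is the maximal ideal of the
polynomials vanishing at `a`. -/
abbrev AffineLocalRing {σ : Type*} (a : σ → ℝ) : Type _ :=
  Localization.AtPrime (MvPolynomial.vanishingIdeal ℝ ({a} : Set (σ → ℝ)))

/-- The local ring `ℝ[x]_{𝔫_a} / I(V) ℝ[x]_{𝔫_a}` of `V` at `a`. -/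
abbrev LocalRing {σ : Type*} (V : Set (σ → ℝ)) (a : σ → ℝ) : Type _ :=
  AffineLocalRing a ⧸
    (MvPolynomial.vanishingIdeal ℝ V).map (algebraMap (MvPolynomial σ ℝ) (AffineLocalRing a))

/-- `V` is nonsingular: at each of its points, its local ring is a regular local ring of
dimension `dim V`. -/
def IsNonsingular {σ : Type*} (V : Set (σ → ℝ)) : Prop :=
  ∀ a ∈ V, IsRegularLocalRing (LocalRing V a) ∧ ringKrullDim (LocalRing V a) = dim V

/-- The map `f` is regular on `S`: each of its coordinates is on `S` a quotient `p / q` of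
polynomials whose denominator has no zero in `S`. -/
def IsRegularOn {σ τ : Type*} (f : (σ → ℝ) → (τ → ℝ)) (S : Set (σ → ℝ)) : Prop :=
  ∀ j, ∃ p q : MvPolynomial σ ℝ, ∀ x ∈ S,
    MvPolynomial.eval x q ≠ 0 ∧ f x j = MvPolynomial.eval x p / MvPolynomial.eval x q

/-- `f` restricts to a biregular isomorphism from `S` onto `T`. -/
def IsBiregularOn {σ τ : Type*} (f : (σ → ℝ) → (τ → ℝ)) (S : Set (σ → ℝ))
    (T : Set (τ → ℝ)) : Prop :=
  IsRegularOn f S ∧ Set.MapsTo f S T ∧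
    ∃ g : (τ → ℝ) → (σ → ℝ), IsRegularOn g T ∧ Set.MapsTo g T S ∧ Set.InvOn g f S T

/-- `U` is a Zariski open subset of `V`. -/
def IsZariskiOpenIn {σ : Type*} (U V : Set (σ → ℝ)) : Prop :=
  ∃ T : Set (σ → ℝ), IsAlgebraicSet ℝ T ∧ U = V \ T

/-- `U` is Zariski dense in `V`: every real algebraic set containing `U` contains `V`. -/
def IsZariskiDenseIn {σ : Type*} (U V : Set (σ → ℝ)) : Prop :=
  ∀ T : Set (σ → ℝ), IsAlgebraicSet ℝ T → U ⊆ T → V ⊆ T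

/-- `f` restricts to a birational (regular) map `V' → V`: it restricts to a regular map `V' → V`
and, further, to a biregular isomorphism between Zariski open dense subsets of `V'` and `V`. -/
def IsBirationalOn {σ τ : Type*} (f : (σ → ℝ) → (τ → ℝ)) (V' : Set (σ → ℝ))
    (V : Set (τ → ℝ)) : Prop :=
  IsRegularOn f V' ∧ Set.MapsTo f V' V ∧
    ∃ (U' : Set (σ → ℝ)) (U : Set (τ → ℝ)),
      IsZariskiOpenIn U' V' ∧ IsZariskiDenseIn U' V' ∧
      IsZariskiOpenIn U V ∧ IsZariskiDenseIn U V ∧ IsBiregularOn f U' U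

/-- `V' ⊆ ℝ^σ × ℝ^τ` is a desingularization of the `ℚ`-algebraic set `V ⊆ ℝ^σ`: it is a
nonsingular real algebraic set with `dim V' = dim V`, and the projection `ℝ^σ × ℝ^τ → ℝ^σ`
restricts to a birational map `V' → V`. Here `ℝ^σ × ℝ^τ` is `σ ⊕ τ → ℝ`. -/
structure IsDesingularization {σ τ : Type*} (V' : Set (σ ⊕ τ → ℝ)) (V : Set (σ → ℝ)) : Prop where
  base_isAlgebraicSet : IsAlgebraicSet ℚ V
  isAlgebraicSet : IsAlgebraicSet ℝ V'
  dim_eq : dim V' = dim V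
  isNonsingular : IsNonsingular V'
  isBirational : IsBirationalOn (fun (x : σ ⊕ τ → ℝ) (s : σ) => x (Sum.inl s)) V' V

end RealAlg

/-! Embedded Grassmannians, Schubert varieties and Bott–Samelson algebraic sets. -/

namespace Schubert

/-- The embedded Grassmannian of `m`-dimensional subspaces of `ℝ^N`: a subspace is represented by
the matrix of the orthogonal projection onto it. For `N = m + n` this is `𝔾_{m,n}`. -/
def grassmannian (N m : ℕ) : Set (Matrix (Fin N) (Fin N) ℝ) :=
  {X | X.transpose = X ∧ X * X = X ∧ X.trace = m}

/-- The member `ℝ^ℓ` of the canonical complete flag of `ℝ^N`, spanned by the first `ℓ` vectors of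
the canonical basis. -/
def flag (N ℓ : ℕ) : Submodule ℝ (Fin N → ℝ) :=
  Submodule.span ℝ {v | ∃ i : Fin N, (i : ℕ) < ℓ ∧ v = Pi.single i 1}

/-- The matrix `D_ℓ` of the orthogonal projection `ℝ^N → ℝ^ℓ`: diagonal, with `1` in the first `ℓ`
diagonal positions and `0` otherwise. -/
def D (N ℓ : ℕ) : Matrix (Fin N) (Fin N) ℝ :=
  Matrix.diagonal fun i => if (i : ℕ) < ℓ then 1 else 0

/-- `lam = (lam_1, …, lam_m)` is a partition in the `m × n` rectangle,
`n ≥ lam_1 ≥ … ≥ lam_m ≥ 0`. The part `lam_{j+1}` is `lam j` for `j : Fin m`. -/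
def IsPartition {m : ℕ} (n : ℕ) (lam : Fin m → ℕ) : Prop :=
  Antitone lam ∧ ∀ j, lam j ≤ n

/-- `m_k = a_1 + … + a_k`. -/
def mIdx (a : ℕ → ℕ) (k : ℕ) : ℕ := ∑ i ∈ Finset.Icc 1 k, a i

/-- `d_k = m_k + b_0 + … + b_{k-1}`. -/
def dIdx (a b : ℕ → ℕ) (k : ℕ) : ℕ := mIdx a k + ∑ i ∈ Finset.Icc 1 k, b (i - 1)

/-- `c ≥ 1`, `a_1, …, a_c` and `b_0, …, b_{c-1}` are the integers attached to the partition `lam`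
of the `m × n` rectangle: all of them but `a_c` and `b_0` are positive, `a_1 + … + a_c = m`,
`b_0 + … + b_{c-1} = n`, and `lam` has first `a_1` parts equal to `b_1 + … + b_{c-1}`, then `a_2`
parts equal to `b_2 + … + b_{c-1}`, and so on, ending with `a_c` parts equal to `0`.
(`a i` with `i ∉ [1, c]` and `b i` with `i ≥ c` play no role.) -/
structure IsStaircase {m : ℕ} (n : ℕ) (lam : Fin m → ℕ) (c : ℕ) (a b : ℕ → ℕ) : Prop where
  c_pos : 1 ≤ c
  a_pos : ∀ i, 1 ≤ i → i < c → 0 < a i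
  b_pos : ∀ i, 1 ≤ i → i < c → 0 < b i
  sum_a : ∑ i ∈ Finset.Icc 1 c, a i = m
  sum_b : ∑ i ∈ Finset.range c, b i = n
  parts : ∀ (j : Fin m) (i : ℕ), 1 ≤ i → i ≤ c → mIdx a (i - 1) < (j : ℕ) + 1 →
    (j : ℕ) + 1 ≤ mIdx a i → lam j = ∑ k ∈ Finset.Ico i c, b k

/-- The square matrix with entries `x (i, j)`. -/
def toMatrix {N : ℕ} (x : Fin N × Fin N → ℝ) : Matrix (Fin N) (Fin N) ℝ :=
  Matrix.of fun i j => x (i, j)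

/-- The Schubert variety `σ_lam ⊆ 𝔾_{m,n} ⊆ ℝ^{(m+n)²}`: the `m`-dimensional subspaces `W` of
`ℝ^{m+n}` such that `dim (W ∩ ℝ^{n+k-lam_k}) ≥ k` for `k = 1, …, m`. Here `W` is the range of its
projection matrix, and `k = j + 1` with `j : Fin m`. -/
def schubertVariety {m : ℕ} (n : ℕ) (lam : Fin m → ℕ) :
    Set (Fin (m + n) × Fin (m + n) → ℝ) :=
  {x | toMatrix x ∈ grassmannian (m + n) m ∧
    ∀ j : Fin m, (j : ℕ) + 1 ≤ Module.finrank ℝ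
      ↥(LinearMap.range (Matrix.toLin' (toMatrix x)) ⊓ flag (m + n) (n + ((j : ℕ) + 1) - lam j))}

/-- The embedded Bott–Samelson algebraic set: the tuples `(X, Y_{c-1}, …, Y_1)` in
`𝔾_{m,n} × 𝔾_{m_{c-1},n_{c-1}} × … × 𝔾_{m_1,n_1}`, `n_k = m + n - m_k`, with
`Y_i D_{d_i} = Y_i` for `i ≤ c - 1`, `Y_{i+1} Y_i = Y_i` for `i ≤ c - 2`, and
`X Y_{c-1} = Y_{c-1}`. The first block of coordinates holds `X`, and the block `i : Fin (c - 1)`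
of the second one holds `Y_{i+1}`. -/
def bottSamelson (m n c : ℕ) (a b : ℕ → ℕ) :
    Set ((Fin (m + n) × Fin (m + n)) ⊕ (Fin (c - 1) × (Fin (m + n) × Fin (m + n))) → ℝ) :=
  {x | ∃ (X : Matrix (Fin (m + n)) (Fin (m + n)) ℝ)
      (Y : Fin (c - 1) → Matrix (Fin (m + n)) (Fin (m + n)) ℝ),
    X = toMatrix (fun s => x (Sum.inl s)) ∧
    (∀ i : Fin (c - 1), Y i = toMatrix (fun s => x (Sum.inr (i, s)))) ∧
    X ∈ grassmannian (m + n) m ∧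
    (∀ i : Fin (c - 1), Y i ∈ grassmannian (m + n) (mIdx a ((i : ℕ) + 1))) ∧
    (∀ i : Fin (c - 1), Y i * D (m + n) (dIdx a b ((i : ℕ) + 1)) = Y i) ∧
    (∀ i j : Fin (c - 1), (j : ℕ) = (i : ℕ) + 1 → Y j * Y i = Y i) ∧
    (∀ i : Fin (c - 1), (i : ℕ) + 1 = c - 1 → X * Y i = Y i)}

end Schubert

/-! A point of Z is a flag W_1 ⊆ … ⊆ W_c = im X with W_i ⊆ ℝ^{d_i} and dim W_i = m_i, and σ consists
of the possible W_c (`mem_schubertVariety_iff_exists`). Put δ = `bsDim` = ∑_{i<c} (b_0 + … + b_i)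
a_{i+1}. Dimension and smoothness both come from the chain δ ≤ dim σ ≤ dim Z ≤ dim T_y Z ≤ δ, valid
at every point y of Z.

Irreducibility: Z is the image of a rational map from an affine space, which sends a frame adapted
to the flag to the orthogonal projections onto the spans of its first columns. So I(Z) is the kernel
of a map to a field of rational functions (`isPrime_vanishingIdeal_bottSamelson`). As σ is the
projection of Z, it is irreducible too and dim σ ≤ dim Z.

Upper bound: by the linearized equations, a tangent vector is determined by its compressions from
W_{i+1} ⊖ W_i to ℝ^{d_{i+1}} ⊖ W_{i+1} (`finrank_tangentSpace_bottSamelson_le`). Lower bound: frames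
in echelon form have δ free entries, and these are rational functions of X
(`bsDim_le_dim_schubertVariety`). Since the tangent space bounds the embedding dimension, the
equalities make all local rings regular.

Birationality: where dim(W_c ∩ ℝ^{d_i}) = m_i for all i, necessarily W_i = W_c ∩ ℝ^{d_i}. This
intersection is the kernel of the symmetric matrix D(1 - X)D + (1 - D), whose orthogonal projection
is rational in X through the characteristic polynomial (`charpolyShift_spec`). The low coefficients
of the same characteristic polynomials are the rational equations of σ. -/

section

/-! ### Dimension of finitely generated domains over a field. -/

open MvPolynomial Ideal

namespace Polynomial

/-- Over a Jacobson ring a maximal ideal of R[X] contracts to a maximal ideal, and passing back up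
adds one to the height. -/
theorem height_of_isMaximal {R : Type*} [CommRing R] [IsNoetherianRing R] [IsJacobsonRing R]
    {n : ℕ∞} (h : ∀ p : Ideal R, p.IsMaximal → p.height = n) (P : Ideal (Polynomial R))
    [hP : P.IsMaximal] : P.height = n + 1 := by
  have : (P.under R).IsMaximal := Polynomial.isMaximal_comap_C_of_isJacobsonRing P
  rw [Polynomial.height_eq_height_add_one (P.under R) P, h _ this]

end Polynomial

namespace MvPolynomial

theorem height_of_isMaximal {k : Type*} [Field k] (n : ℕ) (P : Ideal (MvPolynomial (Fin n) k))
    [hP : P.IsMaximal] : P.height = n := by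
  induction n with
  | zero =>
    have h : ringKrullDim (MvPolynomial (Fin 0) k) = 0 := by
      simp [ringKrullDim_eq_zero_of_field]
    have := Ideal.height_le_ringKrullDim_of_ne_top hP.ne_top
    rw [h] at this
    have h2 : P.height ≤ 0 := by exact_mod_cast this
    simpa using h2
  | succ n ih =>
    let e := (finSuccEquiv k n).toRingEquiv
    let Q : Ideal (Polynomial (MvPolynomial (Fin n) k)) := P.map e
    have hQ : Q.IsMaximal := Ideal.map_isMaximal_of_equiv e
    rw [← e.height_map P]
    have := Polynomial.height_of_isMaximal (fun p hp => ih p) Q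
    exact_mod_cast this

end MvPolynomial

namespace Algebra

/-- Going down gives height P = height p + height of P in the fibre S/pS. The fibre is finite over
the field R/p, hence Artinian, and contributes 0. -/
theorem height_eq_height_under_of_isIntegral {R S : Type*} [CommRing R] [CommRing S] [IsDomain S]
    [Algebra R S] [FaithfulSMul R S] [Module.Finite R S] [IsIntegrallyClosed R]
    [IsNoetherianRing R] (P : Ideal S) [hP : P.IsMaximal] : P.height = (P.under R).height := by
  have : IsNoetherianRing S := IsNoetherianRing.of_finite R S
  set p := P.under R with hp
  have hpm : p.IsMaximal := Ideal.isMaximal_comap_of_isIntegral_of_isMaximal P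
  rw [Ideal.height_eq_height_add_of_liesOver_of_hasGoingDown p P]
  let _ : Field (R ⧸ p) := Ideal.Quotient.field p
  let T := S ⧸ p.map (algebraMap R S)
  have hfin : Module.Finite (R ⧸ p) T := by
    have : Module.Finite R T := inferInstance
    exact Module.Finite.of_restrictScalars_finite R (R ⧸ p) T
  have : IsArtinianRing T := IsArtinianRing.of_finite (R ⧸ p) T
  have hmax : (P.map (Ideal.Quotient.mk (p.map (algebraMap R S)))).IsMaximal := by
    refine .map_of_surjective_of_ker_le Ideal.Quotient.mk_surjective ?_
    rw [Ideal.mk_ker]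
    exact Ideal.map_comap_le
  have h0 : (P.map (Ideal.Quotient.mk (p.map (algebraMap R S)))).height = 0 := by
    rw [Ideal.height_eq_zero_iff]
    have : Ring.KrullDimLE 0 T := inferInstance
    exact Ideal.mem_minimalPrimes_of_krullDimLE_zero _
  rw [h0, add_zero]

/-- The Krull dimension of a finitely generated domain over a field is its transcendence degree,
and it is the height of every maximal ideal. -/
theorem exists_ringKrullDim_eq_trdeg (k A : Type*) [Field k] [CommRing A] [IsDomain A]
    [Algebra k A] [Algebra.FiniteType k A] :
    ∃ s : ℕ, ringKrullDim A = s ∧ Algebra.trdeg k A = s ∧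
      ∀ P : Ideal A, P.IsMaximal → P.height = s := by
  -- Noether normalization: heights and transcendence degree are read off on a polynomial ring in s
  -- variables over which A is finite.
  obtain ⟨s, g, hg, hfin⟩ := exists_finite_inj_algHom_of_fg k A
  let _ : Algebra (MvPolynomial (Fin s) k) A := g.toRingHom.toAlgebra
  have : IsScalarTower k (MvPolynomial (Fin s) k) A := IsScalarTower.of_algebraMap_eq fun x => by
    change _ = g _
    simp
  have hmf : Module.Finite (MvPolynomial (Fin s) k) A := hfin
  have hf : FaithfulSMul (MvPolynomial (Fin s) k) A :=
    (faithfulSMul_iff_algebraMap_injective _ _).mpr hg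
  have hh : ∀ P : Ideal A, P.IsMaximal → P.height = s := by
    intro P hP
    rw [height_eq_height_under_of_isIntegral (R := MvPolynomial (Fin s) k) P]
    have : (P.under (MvPolynomial (Fin s) k)).IsMaximal :=
      Ideal.isMaximal_comap_of_isIntegral_of_isMaximal P
    exact MvPolynomial.height_of_isMaximal s _
  refine ⟨s, le_antisymm ?_ ?_, ?_, hh⟩
  · have := Algebra.FiniteType.isNoetherianRing k A
    refine (ringKrullDim_le_iff_isMaximal_height_le _).mpr fun M hM => ?_
    rw [hh M hM]
    rfl
  · obtain ⟨M, hM⟩ := Ideal.exists_maximal A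
    have := Ideal.height_le_ringKrullDim_of_ne_top hM.ne_top
    rw [hh M hM] at this
    exact this
  · have h1 := lift_trdeg_add_eq k (MvPolynomial (Fin s) k) A
    have : Algebra.IsAlgebraic (MvPolynomial (Fin s) k) A := inferInstance
    rw [trdeg_eq_zero (R := MvPolynomial (Fin s) k), MvPolynomial.trdeg_of_isDomain] at h1
    simp only [Cardinal.mk_fin, Cardinal.lift_natCast, Cardinal.lift_zero, add_zero] at h1
    exact (Cardinal.lift_eq_nat_iff.mp h1.symm)

theorem ringKrullDim_le_of_injective {k A B : Type*} [Field k] [CommRing A] [IsDomain A]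
    [Algebra k A] [Algebra.FiniteType k A] [CommRing B] [IsDomain B]
    [Algebra k B] [Algebra.FiniteType k B] (f : A →ₐ[k] B) (hf : Function.Injective f) :
    ringKrullDim A ≤ ringKrullDim B := by
  obtain ⟨s, hs, hs', -⟩ := exists_ringKrullDim_eq_trdeg k A
  obtain ⟨t, ht, ht', -⟩ := exists_ringKrullDim_eq_trdeg k B
  have := lift_trdeg_le_of_injective f hf
  rw [hs', ht'] at this
  rw [hs, ht]
  simp at this
  exact_mod_cast this

/-- If the variables of a polynomial ring are quotients of elements of the image of `A`, then the
number of variables is at most the Krull dimension of `A`. -/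
theorem card_le_ringKrullDim {k A ι : Type*} [Field k] [Fintype ι] [CommRing A]
    [Algebra k A] [Algebra.FiniteType k A] {K : Type*} [Field K] [Algebra k K]
    [Algebra (MvPolynomial ι k) K] [IsFractionRing (MvPolynomial ι k) K]
    [IsScalarTower k (MvPolynomial ι k) K]
    (f : A →ₐ[k] K)
    (h : ∀ i, ∃ p q, f q ≠ 0 ∧ f p = f q * algebraMap (MvPolynomial ι k) K (X i)) :
    (Fintype.card ι : WithBot ℕ∞) ≤ ringKrullDim A := by
  have hft : Algebra.FiniteType k f.range := Algebra.FiniteType.of_surjective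
    f.rangeRestrict f.rangeRestrict_surjective
  -- A need not be a domain, but its image in K is, and passing to the image can only lower the
  -- dimension.
  refine le_trans ?_ (ringKrullDim_le_of_surjective f.rangeRestrict.toRingHom
    f.rangeRestrict_surjective)
  obtain ⟨s, hs, hs', -⟩ := exists_ringKrullDim_eq_trdeg k f.range
  rw [hs]
  -- Each variable is a root of the linear polynomial f(q)T - f(p) over the image, so K is algebraic
  -- over it and both have the same transcendence degree.
  have halg : Algebra.IsAlgebraic f.range K := by
    have hX : ∀ i, algebraMap (MvPolynomial ι k) K (X i) ∈
        Subalgebra.algebraicClosure f.range K := by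
      intro i
      obtain ⟨p, q, hq, hpq⟩ := h i
      refine ⟨Polynomial.C (f.rangeRestrict q) * Polynomial.X - Polynomial.C (f.rangeRestrict p),
        ?_, ?_⟩
      · intro h0
        have := congrArg (fun P => (P.coeff 1 : K)) h0
        simp at this
        exact hq this
      · simp [hpq]
    have hP : ∀ P, algebraMap (MvPolynomial ι k) K P ∈
        Subalgebra.algebraicClosure f.range K := by
      intro P
      induction P using MvPolynomial.induction_on with
      | C a =>
        have : algebraMap (MvPolynomial ι k) K (C a) = algebraMap f.range K (algebraMap k _ a) := by
          rw [← MvPolynomial.algebraMap_eq, ← IsScalarTower.algebraMap_apply,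
            ← IsScalarTower.algebraMap_apply]
        rw [this]
        exact Subalgebra.algebraMap_mem _ _
      | add p q hp hq => rw [map_add]; exact add_mem hp hq
      | mul_X p i hp => rw [map_mul]; exact mul_mem hp (hX i)
    constructor
    intro x
    obtain ⟨a, b, hb, rfl⟩ := IsFractionRing.div_surjective (A := MvPolynomial ι k) x
    rw [div_eq_mul_inv]
    exact IsAlgebraic.mul (hP a) (IsAlgebraic.inv (hP b))
  have h1 := lift_trdeg_add_eq k f.range K
  rw [trdeg_eq_zero (R := f.range), Cardinal.lift_zero, add_zero, hs', Cardinal.lift_id,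
    Cardinal.lift_id] at h1
  have hind : AlgebraicIndependent k fun i => algebraMap (MvPolynomial ι k) K (X i) := by
    have h2 := (MvPolynomial.algebraicIndependent_X ι k).map'
      (f := IsScalarTower.toAlgHom k (MvPolynomial ι k) K)
      (IsFractionRing.injective (MvPolynomial ι k) K)
    exact h2
  have := hind.lift_cardinalMk_le_trdeg
  rw [← h1] at this
  simp at this
  exact_mod_cast this

end Algebra

end

/-! ### Local rings and Zariski tangent spaces of real algebraic sets. -/

section

open MvPolynomial Ideal

namespace RealAlg

section LocalRing

variable {σ : Type*}

theorem X_sub_C_mem (a : σ → ℝ) (i : σ) : X i - C (a i) ∈ vanishingIdeal ℝ ({a} : Set (σ → ℝ)) := by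
  simp

/-- Localization commutes with quotients: since I(V) ⊆ 𝔫_a, the complement of 𝔫_a maps exactly onto
the complement of its image P in the coordinate ring. -/
theorem isLocalization_localRing (V : Set (σ → ℝ)) {a : σ → ℝ} (ha : a ∈ V) :
    ∃ P : Ideal (MvPolynomial σ ℝ ⧸ vanishingIdeal ℝ V), ∃ _ : P.IsMaximal,
      IsLocalization.AtPrime (LocalRing V a) P := by
  have hle : vanishingIdeal ℝ V ≤ vanishingIdeal ℝ ({a} : Set (σ → ℝ)) :=
    vanishingIdeal_anti_mono (by simpa using ha)
  let P := (vanishingIdeal ℝ ({a} : Set (σ → ℝ))).map (Ideal.Quotient.mk (vanishingIdeal ℝ V))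
  have hP : P.IsMaximal := by
    refine .map_of_surjective_of_ker_le Ideal.Quotient.mk_surjective ?_
    rwa [Ideal.mk_ker]
  refine ⟨P, hP, ?_⟩
  have h1 : IsLocalization (Algebra.algebraMapSubmonoid
      (MvPolynomial σ ℝ ⧸ vanishingIdeal ℝ V) (vanishingIdeal ℝ ({a} : Set (σ → ℝ))).primeCompl)
      (LocalRing V a) := inferInstance
  have h2 : Algebra.algebraMapSubmonoid
      (MvPolynomial σ ℝ ⧸ vanishingIdeal ℝ V) (vanishingIdeal ℝ ({a} : Set (σ → ℝ))).primeCompl =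
      P.primeCompl := by
    ext x
    have hc : P.comap (Ideal.Quotient.mk (vanishingIdeal ℝ V)) =
        vanishingIdeal ℝ ({a} : Set (σ → ℝ)) := by
      rw [Ideal.comap_map_of_surjective' _ Ideal.Quotient.mk_surjective, Ideal.mk_ker]
      exact sup_eq_left.mpr hle
    constructor
    · rintro ⟨y, hy, rfl⟩
      intro h
      apply hy
      rw [SetLike.mem_coe, ← hc]
      exact h
    · intro hx
      obtain ⟨y, rfl⟩ := Ideal.Quotient.mk_surjective x
      refine ⟨y, fun hy => hx ?_, rfl⟩
      exact Ideal.mem_map_of_mem _ hy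
  rw [h2] at h1
  exact h1

theorem isLocalRing_localRing (V : Set (σ → ℝ)) {a : σ → ℝ} (ha : a ∈ V) :
    IsLocalRing (LocalRing V a) := by
  obtain ⟨P, hP, h⟩ := isLocalization_localRing V ha
  exact IsLocalization.AtPrime.isLocalRing (LocalRing V a) P

/-- Nakayama: generators of the maximal ideal modulo its square generate it. -/
theorem spanFinrank_le_ncard_of_le_sup_sq {S : Type*} [CommRing S] [IsLocalRing S]
    [IsNoetherianRing S] {s : Set S} (hs : s.Finite)
    (hsm : s ⊆ IsLocalRing.maximalIdeal S)
    (h : IsLocalRing.maximalIdeal S ≤ Ideal.span s ⊔ IsLocalRing.maximalIdeal S ^ 2) :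
    (IsLocalRing.maximalIdeal S).spanFinrank ≤ s.ncard := by
  have : Ideal.span s = IsLocalRing.maximalIdeal S := by
    refine le_antisymm (Ideal.span_le.mpr hsm) ?_
    apply Submodule.le_of_le_smul_of_le_jacobson_bot (I := IsLocalRing.maximalIdeal S)
    · exact (isNoetherianRing_iff_ideal_fg _).mp inferInstance _
    · exact IsLocalRing.maximalIdeal_le_jacobson _
    · rwa [smul_eq_mul, ← pow_two]
  rw [← this]
  exact Submodule.spanFinrank_span_le_ncard_of_finite hs

theorem map_mk_maximalIdeal {B : Type*} [CommRing B] [IsLocalRing B] {J : Ideal B}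
    [IsLocalRing (B ⧸ J)] (hJ : J ≤ IsLocalRing.maximalIdeal B) :
    (IsLocalRing.maximalIdeal B).map (Ideal.Quotient.mk J) = IsLocalRing.maximalIdeal (B ⧸ J) := by
  apply IsLocalRing.eq_maximalIdeal
  refine .map_of_surjective_of_ker_le Ideal.Quotient.mk_surjective ?_
  rwa [Ideal.mk_ker]

end LocalRing

section Taylor

variable {σ : Type*} [Fintype σ]

/-- The differential at `a` of a polynomial function. -/
noncomputable def differential (a : σ → ℝ) : MvPolynomial σ ℝ →ₗ[ℝ] Module.Dual ℝ (σ → ℝ) where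
  toFun f := ∑ i, eval a (pderiv i f) • LinearMap.proj i
  map_add' f g := by simp [add_smul, Finset.sum_add_distrib]
  map_smul' c f := by simp [Finset.smul_sum, mul_smul, smul_eval]

theorem differential_apply (a : σ → ℝ) (f : MvPolynomial σ ℝ) (v : σ → ℝ) :
    differential a f v = ∑ i, eval a (pderiv i f) * v i := by
  simp [differential, LinearMap.sum_apply]

open Classical in
/-- The polynomial vanishing at `a` with a given linear part. -/
noncomputable def linearPoly (a : σ → ℝ) : Module.Dual ℝ (σ → ℝ) →ₗ[ℝ] MvPolynomial σ ℝ where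
  toFun l := ∑ i, l (Pi.single i 1) • (X i - C (a i))
  map_add' f g := by simp [add_smul, Finset.sum_add_distrib]
  map_smul' c f := by simp [Finset.smul_sum, mul_smul]

theorem linearPoly_differential (a : σ → ℝ) (f : MvPolynomial σ ℝ) :
    linearPoly a (differential a f) = ∑ i, eval a (pderiv i f) • (X i - C (a i)) := by
  classical
  simp only [linearPoly, LinearMap.coe_mk, AddHom.coe_mk, differential_apply]
  refine Finset.sum_congr rfl fun i _ => ?_
  simp [Pi.single_apply]

theorem linearPoly_mem (a : σ → ℝ) (l : Module.Dual ℝ (σ → ℝ)) :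
    linearPoly a l ∈ vanishingIdeal ℝ ({a} : Set (σ → ℝ)) :=
  Ideal.sum_mem _ fun i _ => Submodule.smul_of_tower_mem _ _ (X_sub_C_mem a i)

/-- First-order Taylor expansion. It identifies the class modulo 𝔫_a² of a polynomial vanishing at a
with its differential. -/
theorem taylor_mem_sq (a : σ → ℝ) (f : MvPolynomial σ ℝ) :
    f - C (eval a f) - linearPoly a (differential a f) ∈
      vanishingIdeal ℝ ({a} : Set (σ → ℝ)) ^ 2 := by
  classical
  induction f using MvPolynomial.induction_on with
  | C c => simp [linearPoly_differential]
  | add p q hp hq =>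
    convert! add_mem hp hq using 1
    simp only [map_add]
    ring
  | mul_X p i hp =>
    -- The remainder of p·X_i is a_i times the remainder of p, plus (p - p(a))(X_i - a_i), and the
    -- latter lies in 𝔫_a².
    have h1 : p - C (eval a p) ∈ vanishingIdeal ℝ ({a} : Set (σ → ℝ)) := by
      simp [aeval_eq_eval]
    have h2 := Ideal.mul_mem_mul h1 (X_sub_C_mem a i)
    rw [← pow_two] at h2
    convert! add_mem (Ideal.mul_mem_left _ (C (a i)) hp) h2 using 1
    have : linearPoly a (differential a (p * X i)) =
        C (a i) * linearPoly a (differential a p) + C (eval a p) * (X i - C (a i)) := by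
      simp only [linearPoly_differential, Derivation.leibniz, pderiv_X, smul_eq_mul, map_add,
        map_mul, eval_X, smul_eq_C_mul, add_mul, Finset.sum_add_distrib, Finset.mul_sum]
      rw [add_comm]
      congr 1
      · refine Finset.sum_congr rfl fun j _ => ?_
        ring
      · rw [Finset.sum_eq_single i]
        · simp
        · intro j _ hj
          simp [hj]
        · simp
    rw [this]
    simp only [map_mul, eval_X]
    ring

/-- The Zariski tangent space of `V` at `a`. -/
noncomputable def tangentSpace (V : Set (σ → ℝ)) (a : σ → ℝ) : Submodule ℝ (σ → ℝ) :=
  (((vanishingIdeal ℝ V).restrictScalars ℝ).map (differential a)).dualCoannihilator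

theorem mem_tangentSpace {V : Set (σ → ℝ)} {a v : σ → ℝ} :
    v ∈ tangentSpace V a ↔ ∀ f ∈ vanishingIdeal ℝ V, differential a f v = 0 := by
  simp [tangentSpace, Submodule.mem_dualCoannihilator]

/-- In a finitely generated domain all maximal ideals have the same height, so irreducibility makes
the local dimension equal to the global one. -/
theorem ringKrullDim_localRing {V : Set (σ → ℝ)} (hV : (vanishingIdeal ℝ V).IsPrime)
    {a : σ → ℝ} (ha : a ∈ V) : ringKrullDim (LocalRing V a) = dim V := by
  obtain ⟨P, hP, h⟩ := isLocalization_localRing V ha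
  obtain ⟨s, h1, -, h2⟩ := Algebra.exists_ringKrullDim_eq_trdeg ℝ
    (MvPolynomial σ ℝ ⧸ vanishingIdeal ℝ V)
  have h3 := IsLocalization.AtPrime.ringKrullDim_eq_height P (LocalRing V a)
  rw [h2 P hP] at h3
  exact h3.trans h1.symm

/-- The cotangent space of S is spanned by linear forms modulo G, the differentials of I(V). A basis
of a complement of G therefore generates the maximal ideal modulo its square, and dim G' is the
dimension of the annihilator of G, the tangent space. -/
theorem spanFinrank_maximalIdeal_le_of_map {V : Set (σ → ℝ)} {a : σ → ℝ} (ha : a ∈ V)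
    {S : Type*} [CommRing S] [IsLocalRing S] [IsNoetherianRing S] (π : MvPolynomial σ ℝ →+* S)
    (hmax : (vanishingIdeal ℝ ({a} : Set (σ → ℝ))).map π = IsLocalRing.maximalIdeal S)
    (hπ : ∀ f ∈ vanishingIdeal ℝ V, π f = 0) :
    (IsLocalRing.maximalIdeal S).spanFinrank ≤ Module.finrank ℝ (tangentSpace V a) := by
  classical
  set 𝔫 := vanishingIdeal ℝ ({a} : Set (σ → ℝ)) with h𝔫
  let G := ((vanishingIdeal ℝ V).restrictScalars ℝ).map (differential a)
  obtain ⟨G', hG'⟩ := Submodule.exists_isCompl G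
  have hdim : Module.finrank ℝ G' = Module.finrank ℝ (tangentSpace V a) := by
    have h1 := Subspace.finrank_add_finrank_dualCoannihilator_eq G
    have h2 := Submodule.finrank_add_eq_of_isCompl hG'
    rw [Subspace.dual_finrank_eq] at h2
    change _ = Module.finrank ℝ G.dualCoannihilator
    omega
  have : Module.Free ℝ G' := Module.Free.of_divisionRing ℝ G'
  let b := Module.finBasis ℝ G'
  let s : Set S := Set.range fun j => π (linearPoly a (b j))
  have hs : (IsLocalRing.maximalIdeal S).spanFinrank ≤ s.ncard := by
    refine spanFinrank_le_ncard_of_le_sup_sq (Set.finite_range _) ?_ ?_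
    · rintro _ ⟨j, rfl⟩
      rw [SetLike.mem_coe, ← hmax]
      exact Ideal.mem_map_of_mem _ (linearPoly_mem a _)
    have hsq : ∀ f ∈ 𝔫 ^ 2, π f ∈ Ideal.span s ⊔ IsLocalRing.maximalIdeal S ^ 2 := by
      intro f hf
      apply Submodule.mem_sup_right
      rw [← hmax, ← Ideal.map_pow]
      exact Ideal.mem_map_of_mem _ hf
    conv_lhs => rw [← hmax]
    rw [Ideal.map_le_iff_le_comap]
    intro f hf
    have hf0 : eval a f = 0 := by
      simpa [h𝔫, mem_vanishingIdeal_singleton_iff, aeval_eq_eval] using hf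
    rw [Ideal.mem_comap]
    have ht := hsq _ (taylor_mem_sq a f)
    rw [hf0, map_zero, sub_zero, map_sub] at ht
    rw [← sub_add_cancel (π f) (π (linearPoly a (differential a f)))]
    refine add_mem ht ?_
    have hd : differential a f ∈ G ⊔ G' := by rw [hG'.sup_eq_top]; trivial
    obtain ⟨g, hg, g', hg', hgg⟩ := Submodule.mem_sup.mp hd
    obtain ⟨h, hh, rfl⟩ := hg
    rw [← hgg, map_add, map_add]
    refine add_mem ?_ ?_
    -- As π kills h ∈ I(V), the Taylor expansion of h puts the image of its linear part in the
    -- square of the maximal ideal.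
    · have hh0 : eval a h = 0 := by
        have := (mem_vanishingIdeal_iff.mp hh) a ha
        simpa [aeval_eq_eval] using this
      have ht := hsq _ (taylor_mem_sq a h)
      rw [hh0, map_zero, sub_zero, map_sub] at ht
      rw [hπ h hh, zero_sub] at ht
      exact neg_mem_iff.mp ht
    · apply Submodule.mem_sup_left
      have := b.sum_repr ⟨g', hg'⟩
      have h3 := congrArg (Submodule.subtype G') this
      simp only [map_sum, map_smul, Submodule.subtype_apply] at h3
      rw [← h3, map_sum, map_sum]
      refine Ideal.sum_mem _ fun j _ => ?_
      rw [map_smul, smul_eq_C_mul, map_mul]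
      exact Ideal.mul_mem_left _ _ (Ideal.subset_span ⟨j, rfl⟩)
  rw [← hdim]
  refine hs.trans ?_
  rw [← Nat.card_coe_set_eq]
  refine (Finite.card_range_le _).trans ?_
  simp

theorem spanFinrank_maximalIdeal_quotient_le {V : Set (σ → ℝ)} {a : σ → ℝ} (ha : a ∈ V)
    {B : Type*} [CommRing B] [IsLocalRing B] [IsNoetherianRing B] (ρ : MvPolynomial σ ℝ →+* B)
    (hmax : (vanishingIdeal ℝ ({a} : Set (σ → ℝ))).map ρ = IsLocalRing.maximalIdeal B)
    [IsLocalRing (B ⧸ (vanishingIdeal ℝ V).map ρ)] :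
    (IsLocalRing.maximalIdeal (B ⧸ (vanishingIdeal ℝ V).map ρ)).spanFinrank ≤
      Module.finrank ℝ (tangentSpace V a) := by
  have hle : vanishingIdeal ℝ V ≤ vanishingIdeal ℝ ({a} : Set (σ → ℝ)) :=
    vanishingIdeal_anti_mono (by simpa using ha)
  refine spanFinrank_maximalIdeal_le_of_map ha ((Ideal.Quotient.mk _).comp ρ) ?_ fun f hf =>
    Ideal.Quotient.eq_zero_iff_mem.mpr (Ideal.mem_map_of_mem _ hf)
  rw [← Ideal.map_map, hmax]
  apply map_mk_maximalIdeal
  rw [← hmax]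
  exact Ideal.map_mono hle

theorem spanFinrank_maximalIdeal_le {V : Set (σ → ℝ)} {a : σ → ℝ} (ha : a ∈ V)
    [h : IsLocalRing (LocalRing V a)] :
    (IsLocalRing.maximalIdeal (LocalRing V a)).spanFinrank ≤
      Module.finrank ℝ (tangentSpace V a) :=
  spanFinrank_maximalIdeal_quotient_le (B := AffineLocalRing a) ha
    (algebraMap (MvPolynomial σ ℝ) (AffineLocalRing a)) Localization.AtPrime.map_eq_maximalIdeal

/-- If the Zariski tangent spaces of an irreducible real algebraic set have dimension at most a
lower bound of its dimension, then it is nonsingular. -/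
theorem isNonsingular_of_finrank_tangentSpace_le {V : Set (σ → ℝ)}
    (hV : (vanishingIdeal ℝ V).IsPrime) {D : ℕ} (hD : D ≤ dim V)
    (hT : ∀ a ∈ V, Module.finrank ℝ (tangentSpace V a) ≤ D) : IsNonsingular V := by
  intro a ha
  refine ⟨?_, ringKrullDim_localRing hV ha⟩
  have := isLocalRing_localRing V ha
  apply IsRegularLocalRing.of_spanFinrank_maximalIdeal_le
  rw [ringKrullDim_localRing hV ha]
  refine le_trans ?_ hD
  exact_mod_cast (spanFinrank_maximalIdeal_le ha).trans (hT a ha)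

/-- The Krull dimension of a Noetherian local ring is at most its embedding dimension. -/
theorem dim_le_finrank_tangentSpace {V : Set (σ → ℝ)}
    (hV : (vanishingIdeal ℝ V).IsPrime) {a : σ → ℝ} (ha : a ∈ V) :
    dim V ≤ Module.finrank ℝ (tangentSpace V a) := by
  have := isLocalRing_localRing V ha
  rw [← ringKrullDim_localRing hV ha]
  refine (ringKrullDim_le_spanFinrank_maximalIdeal (LocalRing V a)).trans ?_
  exact_mod_cast spanFinrank_maximalIdeal_le ha

end Taylor

end RealAlg

end

/-! ### Rational parametrizations, projections and Zariski density. -/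

section

open MvPolynomial Ideal

namespace RealAlg

section Parametrization

variable {σ τ : Type*}

/-- The point with coordinates `φ s / q` at the parameter `t`. -/
noncomputable def paramPoint (q : MvPolynomial τ ℝ) (φ : σ → MvPolynomial τ ℝ) (t : τ → ℝ) :
    σ → ℝ := fun s => eval t (φ s) / eval t q

/-- Clearing denominators. One polynomial g serves both in the function field and at every
admissible parameter, which lets identities pass between the two. -/
theorem exists_aeval_param {K : Type*} [Field K] [Algebra ℝ K] [Algebra (MvPolynomial τ ℝ) K]
    [IsFractionRing (MvPolynomial τ ℝ) K] [IsScalarTower ℝ (MvPolynomial τ ℝ) K]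
    {q : MvPolynomial τ ℝ} (hq : q ≠ 0) (φ : σ → MvPolynomial τ ℝ) (f : MvPolynomial σ ℝ) :
    ∃ (n : ℕ) (g : MvPolynomial τ ℝ),
      aeval (fun s => algebraMap _ K (φ s) / algebraMap _ K q) f * algebraMap _ K q ^ n =
        algebraMap _ K g ∧
      ∀ t, eval t q ≠ 0 → eval (paramPoint q φ t) f * eval t q ^ n = eval t g := by
  have hq' : algebraMap (MvPolynomial τ ℝ) K q ≠ 0 := by
    rwa [Ne, FaithfulSMul.algebraMap_eq_zero_iff]
  induction f using MvPolynomial.induction_on with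
  | C a =>
    refine ⟨0, C a, ?_, fun t ht => by simp⟩
    rw [← MvPolynomial.algebraMap_eq, ← MvPolynomial.algebraMap_eq, AlgHom.commutes,
      ← IsScalarTower.algebraMap_apply]
    simp
  | add f₁ f₂ h₁ h₂ =>
    obtain ⟨n₁, g₁, h₁, h₁'⟩ := h₁
    obtain ⟨n₂, g₂, h₂, h₂'⟩ := h₂
    refine ⟨n₁ + n₂, g₁ * q ^ n₂ + g₂ * q ^ n₁, ?_, fun t ht => ?_⟩
    · simp only [map_add, map_mul, map_pow, ← h₁, ← h₂]
      ring
    · simp only [map_add, map_mul, map_pow, ← h₁' t ht, ← h₂' t ht]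
      ring
  | mul_X f s h =>
    obtain ⟨n, g, h, h'⟩ := h
    refine ⟨n + 1, g * φ s, ?_, fun t ht => ?_⟩
    · simp only [map_mul, aeval_X, ← h]
      field_simp
      ring
    · simp only [map_mul, eval_X, ← h' t ht, paramPoint]
      field_simp
      ring

/-- The product q g vanishes at every point of an affine space over an infinite field, so it is
zero. -/
theorem eq_zero_of_eval_eq_zero_of_ne {q : MvPolynomial τ ℝ} (hq : q ≠ 0) {g : MvPolynomial τ ℝ}
    (h : ∀ t, eval t q ≠ 0 → eval t g = 0) : g = 0 := by
  have : q * g = 0 := by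
    apply MvPolynomial.funext
    intro t
    rw [map_mul, map_zero]
    by_cases ht : eval t q = 0
    · rw [ht, zero_mul]
    · rw [h t ht, mul_zero]
  exact (mul_eq_zero.mp this).resolve_left hq

theorem exists_eval_ne_zero {q : MvPolynomial τ ℝ} (hq : q ≠ 0) : ∃ t, eval t q ≠ 0 := by
  by_contra! h
  exact hq (MvPolynomial.funext fun t => by rw [h t, map_zero])

theorem aeval_param_eq_zero_iff (K : Type*) [Field K] [Algebra ℝ K] [Algebra (MvPolynomial τ ℝ) K]
    [IsFractionRing (MvPolynomial τ ℝ) K] [IsScalarTower ℝ (MvPolynomial τ ℝ) K]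
    {q : MvPolynomial τ ℝ} (hq : q ≠ 0) (φ : σ → MvPolynomial τ ℝ) (f : MvPolynomial σ ℝ) :
    aeval (fun s => algebraMap _ K (φ s) / algebraMap _ K q) f = 0 ↔
      ∀ t, eval t q ≠ 0 → eval (paramPoint q φ t) f = 0 := by
  have hq' : algebraMap (MvPolynomial τ ℝ) K q ≠ 0 := by
    rwa [Ne, FaithfulSMul.algebraMap_eq_zero_iff]
  obtain ⟨n, g, h, h'⟩ := exists_aeval_param (K := K) hq φ f
  constructor
  · intro h0 t ht
    rw [h0, zero_mul, eq_comm, FaithfulSMul.algebraMap_eq_zero_iff] at h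
    have := h' t ht
    rw [h, map_zero] at this
    exact (mul_eq_zero.mp this).resolve_right (pow_ne_zero _ ht)
  · intro h0
    have hg : g = 0 := eq_zero_of_eval_eq_zero_of_ne hq fun t ht => by
      rw [← h' t ht, h0 t ht, zero_mul]
    rw [hg, map_zero] at h
    exact (mul_eq_zero.mp h).resolve_right (pow_ne_zero _ hq')

/-- The closure of the image of a rational map from an affine space is irreducible. -/
theorem isPrime_vanishingIdeal_of_param {V : Set (σ → ℝ)} {q : MvPolynomial τ ℝ} (hq : q ≠ 0)
    (φ : σ → MvPolynomial τ ℝ) (hV : ∀ x, x ∈ V ↔ ∃ t, eval t q ≠ 0 ∧ paramPoint q φ t = x) :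
    (vanishingIdeal ℝ V).IsPrime := by
  let K := FractionRing (MvPolynomial τ ℝ)
  -- Vanishing on the image means vanishing at the generic point of the parameter space.
  have : vanishingIdeal ℝ V = RingHom.ker
      (aeval (R := ℝ) fun s => algebraMap _ K (φ s) / algebraMap _ K q) := by
    ext f
    rw [RingHom.mem_ker, aeval_param_eq_zero_iff K hq, mem_vanishingIdeal_iff]
    constructor
    · intro h t ht
      exact h _ ((hV _).mpr ⟨t, ht, rfl⟩)
    · intro h x hx
      obtain ⟨t, ht, rfl⟩ := (hV x).mp hx
      exact h t ht
  rw [this]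
  exact RingHom.ker_isPrime _

/-- If `V` contains the image of a rational map from `ℝ^τ` with a rational left inverse, then its
dimension is at least `#τ`. -/
theorem card_le_dim [Finite σ] [Fintype τ] {V : Set (σ → ℝ)} {q : MvPolynomial τ ℝ} (hq : q ≠ 0)
    (φ : σ → MvPolynomial τ ℝ) (hV : ∀ t, eval t q ≠ 0 → paramPoint q φ t ∈ V)
    (h : ∀ i, ∃ p r : MvPolynomial σ ℝ, ∀ t, eval t q ≠ 0 → eval (paramPoint q φ t) r ≠ 0 ∧
      eval (paramPoint q φ t) p = eval (paramPoint q φ t) r * t i) :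
    (Fintype.card τ : WithBot ℕ∞) ≤ dim V := by
  let K := FractionRing (MvPolynomial τ ℝ)
  let ψ := aeval (R := ℝ) fun s => algebraMap _ K (φ s) / algebraMap _ K q
  have hψ : ∀ f ∈ vanishingIdeal ℝ V, ψ f = 0 := fun f hf =>
    (aeval_param_eq_zero_iff K hq φ f).mpr fun t ht => hf _ (hV t ht)
  have hq' : algebraMap (MvPolynomial τ ℝ) K q ≠ 0 := by
    rwa [Ne, FaithfulSMul.algebraMap_eq_zero_iff]
  refine Algebra.card_le_ringKrullDim (k := ℝ) (K := K) (Ideal.Quotient.liftₐ _ ψ hψ) fun i => ?_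
  obtain ⟨p, r, hpr⟩ := h i
  refine ⟨Ideal.Quotient.mk _ p, Ideal.Quotient.mk _ r, ?_, ?_⟩
  · change ψ r ≠ 0
    rw [Ne, aeval_param_eq_zero_iff K hq]
    push Not
    obtain ⟨t, ht⟩ := exists_eval_ne_zero hq
    exact ⟨t, ht, (hpr t ht).1⟩
  · change ψ p = ψ r * algebraMap (MvPolynomial τ ℝ) K (X i)
    obtain ⟨n, g, h₁, h₁'⟩ := exists_aeval_param (K := K) hq φ p
    obtain ⟨n', g', h₂, h₂'⟩ := exists_aeval_param (K := K) hq φ r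
    -- The relation p = r·t_i, known at points only, becomes an identity of polynomials once the
    -- denominators are cleared.
    have hg : g * q ^ n' - g' * X i * q ^ n = 0 :=
      eq_zero_of_eval_eq_zero_of_ne hq fun t ht => by
        simp only [map_sub, map_mul, map_pow, eval_X, ← h₁' t ht, ← h₂' t ht, (hpr t ht).2]
        ring
    have hg' := congrArg (algebraMap (MvPolynomial τ ℝ) K) hg
    simp only [map_sub, map_mul, map_pow, ← h₁, ← h₂, map_zero] at hg'
    have h3 : (ψ p - ψ r * algebraMap (MvPolynomial τ ℝ) K (X i)) *
      (algebraMap _ K q ^ n * algebraMap _ K q ^ n') = 0 := by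
      rw [← hg']
      ring
    exact sub_eq_zero.mp ((mul_eq_zero.mp h3).resolve_right
      (mul_ne_zero (pow_ne_zero _ hq') (pow_ne_zero _ hq')))

end Parametrization

section Projection

variable {σ τ : Type*} {V' : Set (σ ⊕ τ → ℝ)} {V : Set (σ → ℝ)}

/-- Makes I(V) the contraction of I(V'). Primality descends from V' to its projection, and the
coordinate ring of V embeds in that of V'. -/
theorem mem_vanishingIdeal_rename
    (h : ∀ x, x ∈ V ↔ ∃ y ∈ V', (fun s => y (Sum.inl s)) = x) (f : MvPolynomial σ ℝ) :
    rename Sum.inl f ∈ vanishingIdeal ℝ V' ↔ f ∈ vanishingIdeal ℝ V := by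
  simp only [mem_vanishingIdeal_iff, aeval_rename]
  constructor
  · intro hf x hx
    obtain ⟨y, hy, rfl⟩ := (h x).mp hx
    exact hf y hy
  · intro hf y hy
    exact hf _ ((h _).mpr ⟨y, hy, rfl⟩)

theorem isPrime_vanishingIdeal_of_projection
    (h : ∀ x, x ∈ V ↔ ∃ y ∈ V', (fun s => y (Sum.inl s)) = x)
    (hV' : (vanishingIdeal ℝ V').IsPrime) : (vanishingIdeal ℝ V).IsPrime := by
  have : vanishingIdeal ℝ V = (vanishingIdeal ℝ V').comap (rename (R := ℝ) (Sum.inl : σ → σ ⊕ τ)) := by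
    ext f
    exact (mem_vanishingIdeal_rename h f).symm
  rw [this]
  exact Ideal.IsPrime.comap _

theorem dim_le_of_projection [Finite σ] [Finite τ]
    (h : ∀ x, x ∈ V ↔ ∃ y ∈ V', (fun s => y (Sum.inl s)) = x)
    (hV' : (vanishingIdeal ℝ V').IsPrime) : dim V ≤ dim V' := by
  have hV := isPrime_vanishingIdeal_of_projection h hV'
  let f : (MvPolynomial σ ℝ ⧸ vanishingIdeal ℝ V) →ₐ[ℝ] MvPolynomial (σ ⊕ τ) ℝ ⧸ vanishingIdeal ℝ V' :=
    Ideal.Quotient.liftₐ _ ((Ideal.Quotient.mkₐ ℝ _).comp (rename Sum.inl)) fun p hp =>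
      Ideal.Quotient.eq_zero_iff_mem.mpr ((mem_vanishingIdeal_rename h p).mpr hp)
  refine Algebra.ringKrullDim_le_of_injective f ?_
  rw [injective_iff_map_eq_zero]
  intro x hx
  obtain ⟨p, rfl⟩ := Ideal.Quotient.mk_surjective x
  rw [Ideal.Quotient.eq_zero_iff_mem, ← mem_vanishingIdeal_rename h]
  exact Ideal.Quotient.eq_zero_iff_mem.mp hx

end Projection

section Zariski

variable {σ τ : Type*}

/-- If f is an equation of T nonzero somewhere on V and f' vanishes on V \ T, then f f' ∈ I(V), and
primality leaves only f' ∈ I(V). -/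
theorem isZariskiDenseIn_diff {V T : Set (σ → ℝ)} (hV : (vanishingIdeal ℝ V).IsPrime)
    (hT : IsAlgebraicSet ℝ T) (h : (V \ T).Nonempty) : IsZariskiDenseIn (V \ T) V := by
  rintro T' ⟨F', rfl⟩ hsub
  obtain ⟨F, rfl⟩ := hT
  obtain ⟨x₀, hx₀, hx₀'⟩ := h
  simp only [Set.mem_ofPred_eq, not_forall] at hx₀'
  obtain ⟨f, hf, hfx⟩ := hx₀'
  intro x hx f' hf'
  have hmem : f * f' ∈ vanishingIdeal ℝ V := by
    intro y hy
    rw [map_mul]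
    by_cases hy0 : aeval y f = 0
    · rw [hy0, zero_mul]
    · rw [hsub ⟨hy, fun h => hy0 (h f hf)⟩ f' hf', mul_zero]
  exact (hV.mem_or_mem hmem).resolve_left (fun h => hfx (h x₀ hx₀)) x hx

theorem isAlgebraicSet_setOf_aeval_eq_zero {K L : Type*} [Field K] [Field L] [Algebra K L]
    {ι : Type*} (p : ι → MvPolynomial σ K) :
    IsAlgebraicSet K {x : σ → L | ∀ i, aeval x (p i) = 0} :=
  ⟨Set.range p, by simp⟩

theorem IsAlgebraicSet.inter {K L : Type*} [Field K] [Field L] [Algebra K L] {V W : Set (σ → L)}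
    (hV : IsAlgebraicSet K V) (hW : IsAlgebraicSet K W) : IsAlgebraicSet K (V ∩ W) := by
  obtain ⟨F, rfl⟩ := hV
  obtain ⟨G, rfl⟩ := hW
  refine ⟨F ∪ G, ?_⟩
  ext x
  simp only [Set.mem_inter_iff, Set.mem_ofPred_eq, Set.mem_union, or_imp, forall_and]

theorem IsAlgebraicSet.iInter {K L ι : Type*} [Field K] [Field L] [Algebra K L]
    {V : ι → Set (σ → L)} (hV : ∀ i, IsAlgebraicSet K (V i)) : IsAlgebraicSet K (⋂ i, V i) := by
  choose F hF using hV
  refine ⟨⋃ i, F i, ?_⟩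
  ext x
  simp only [hF, Set.mem_iInter, Set.mem_ofPred_eq, Set.mem_iUnion]
  exact ⟨fun h f ⟨i, hf⟩ => h i f hf, fun h i f hf => h f ⟨i, hf⟩⟩

end Zariski

end RealAlg

end

/-! ### Orthogonal projection matrices and subspaces. -/

section

open Matrix

/-- A real symmetric idempotent matrix, that is, the matrix of an orthogonal projection. -/
structure Matrix.IsOrthProj {n : Type*} [Fintype n] (Q : Matrix n n ℝ) : Prop where
  symm : Qᵀ = Q
  idem : Q * Q = Q

namespace Matrix.IsOrthProj

variable {n : Type*} [Fintype n] {P Q : Matrix n n ℝ}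

theorem mul_eq_comm (hP : P.IsOrthProj) (hQ : Q.IsOrthProj) : P * Q = Q ↔ Q * P = Q := by
  constructor <;> intro h
  · have := congrArg transpose h
    rwa [transpose_mul, hP.symm, hQ.symm] at this
  · have := congrArg transpose h
    rwa [transpose_mul, hP.symm, hQ.symm] at this

theorem eq_of_mul_eq (hP : P.IsOrthProj) (hQ : Q.IsOrthProj) (h₁ : P * Q = Q) (h₂ : Q * P = P) :
    P = Q := by
  rw [← (hQ.mul_eq_comm hP).mp h₂, h₁]

theorem sub (hP : P.IsOrthProj) (hQ : Q.IsOrthProj) (h : P * Q = Q) : (P - Q).IsOrthProj := by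
  refine ⟨by rw [transpose_sub, hP.symm, hQ.symm], ?_⟩
  rw [sub_mul, mul_sub, mul_sub, hP.idem, hQ.idem, h, (hP.mul_eq_comm hQ).mp h]
  abel

theorem mem_range_iff (hQ : Q.IsOrthProj) [DecidableEq n] (v : n → ℝ) :
    v ∈ LinearMap.range (toLin' Q) ↔ Q *ᵥ v = v := by
  constructor
  · rintro ⟨w, rfl⟩
    rw [toLin'_apply, mulVec_mulVec, hQ.idem]
  · intro h
    exact ⟨v, by rw [toLin'_apply, h]⟩

/-- The dictionary between the matrix equations of Z and inclusions of subspaces. -/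
theorem mul_eq_iff (hP : P.IsOrthProj) (hQ : Q.IsOrthProj) [DecidableEq n] :
    P * Q = Q ↔ LinearMap.range (toLin' Q) ≤ LinearMap.range (toLin' P) := by
  constructor
  · intro h v hv
    rw [hQ.mem_range_iff] at hv
    rw [hP.mem_range_iff, ← hv, mulVec_mulVec, h]
  · intro h
    apply Matrix.toLin'.injective
    refine LinearMap.ext fun v => ?_
    simp only [toLin'_apply, ← mulVec_mulVec]
    exact (hP.mem_range_iff _).mp (h ⟨v, rfl⟩)

theorem eq_of_range_eq (hP : P.IsOrthProj) (hQ : Q.IsOrthProj) [DecidableEq n]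
    (h : LinearMap.range (toLin' P) = LinearMap.range (toLin' Q)) : P = Q :=
  hP.eq_of_mul_eq hQ ((hP.mul_eq_iff hQ).mpr h.ge) ((hQ.mul_eq_iff hP).mpr h.le)

theorem trace_eq_finrank (hQ : Q.IsOrthProj) [DecidableEq n] :
    Q.trace = Module.finrank ℝ (LinearMap.range (toLin' Q)) := by
  have h : LinearMap.IsProj (LinearMap.range (toLin' Q)) (toLin' Q) :=
    ⟨fun x => ⟨x, rfl⟩, fun x hx => (hQ.mem_range_iff x).mp hx⟩
  rw [← h.trace, Matrix.trace_toLin'_eq]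

theorem dotProduct_mulVec_self (hX : X.IsOrthProj) (v : n → ℝ) :
    v ⬝ᵥ (X *ᵥ v) = (X *ᵥ v) ⬝ᵥ (X *ᵥ v) := by
  conv_rhs => rw [dotProduct_mulVec, vecMul_mulVec, hX.symm, hX.idem]
  rw [dotProduct_mulVec]

theorem of_mul_transpose {J : Type*} [Fintype J] [DecidableEq J] {C : Matrix n J ℝ}
    (hC : Cᵀ * C = 1) : (C * Cᵀ).IsOrthProj := by
  refine ⟨by simp, ?_⟩
  rw [Matrix.mul_assoc, ← Matrix.mul_assoc Cᵀ, hC, Matrix.one_mul]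

end Matrix.IsOrthProj

/-- The columns of C are an orthonormal basis of W, obtained by transporting W to `EuclideanSpace`,
where the norm comes from the dot product. -/
theorem Submodule.exists_orthonormal_matrix {n : Type*} [Fintype n] [DecidableEq n]
    (W : Submodule ℝ (n → ℝ)) {r : ℕ} (hr : Module.finrank ℝ W = r) :
    ∃ C : Matrix n (Fin r) ℝ, Cᵀ * C = 1 ∧ LinearMap.range (toLin' (C * Cᵀ)) = W := by
  let e := (WithLp.linearEquiv 2 ℝ (n → ℝ))
  let W' : Submodule ℝ (EuclideanSpace ℝ n) := W.map e.symm.toLinearMap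
  have hW' : Module.finrank ℝ W' = r := by
    rw [← hr]
    exact e.symm.finrank_map_eq W
  let b := (stdOrthonormalBasis ℝ W').reindex (finCongr hW')
  let C : Matrix n (Fin r) ℝ := Matrix.of fun k j => (b j : EuclideanSpace ℝ n) k
  have hC : Cᵀ * C = 1 := by
    ext i j
    have := b.inner_eq_ite i j
    rw [Matrix.one_apply, ← this, Matrix.mul_apply]
    simp [C, PiLp.inner_apply, mul_comm]
  refine ⟨C, hC, ?_⟩
  ext v
  rw [(Matrix.IsOrthProj.of_mul_transpose hC).mem_range_iff]
  constructor
  · intro h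
    rw [← h, ← mulVec_mulVec]
    have : C *ᵥ (Cᵀ *ᵥ v) = ∑ j, (Cᵀ *ᵥ v) j • e (b j : EuclideanSpace ℝ n) := by
      ext k
      simp [mulVec, dotProduct, C, e, mul_comm]
    rw [this]
    refine Submodule.sum_mem _ fun j _ => Submodule.smul_mem _ _ ?_
    obtain ⟨w, hw, hw'⟩ := (b j).2
    rw [← hw']
    simpa using hw
  · intro h
    have h1 := b.sum_repr' ⟨e.symm v, ⟨v, h, rfl⟩⟩
    ext k
    have h2 := congrArg (fun z : W' => (z : EuclideanSpace ℝ n) k) h1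
    simp [e, PiLp.inner_apply] at h2
    rw [← mulVec_mulVec, ← h2]
    simp only [mulVec, dotProduct, C, transpose_apply, of_apply]
    refine Finset.sum_congr rfl fun j _ => ?_
    rw [mul_comm]
    simp only [mul_comm]

theorem Submodule.exists_finrank_eq {K V : Type*} [Field K] [AddCommGroup V] [Module K V]
    [FiniteDimensional K V] {U W : Submodule K V} (hUW : U ≤ W) {k : ℕ}
    (h₁ : Module.finrank K U ≤ k) (h₂ : k ≤ Module.finrank K W) :
    ∃ S : Submodule K V, U ≤ S ∧ S ≤ W ∧ Module.finrank K S = k := by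
  induction k, h₁ using Nat.le_induction with
  | base => exact ⟨U, le_rfl, hUW, rfl⟩
  | succ k hk ih =>
    obtain ⟨S, hUS, hSW, hS⟩ := ih (by omega)
    have hne : S < W := lt_of_le_of_ne hSW fun h => by
      rw [← h, hS] at h₂
      omega
    obtain ⟨w, hwW, hwS⟩ := SetLike.exists_of_lt hne
    refine ⟨S ⊔ K ∙ w, hUS.trans le_sup_left,
      sup_le hSW ((Submodule.span_singleton_le_iff_mem _ _).mpr hwW), ?_⟩
    rw [Submodule.finrank_sup_span_singleton hwS, hS]

/-! ### Kernels of real symmetric matrices through the characteristic polynomial. -/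

section Kernel

variable {n : Type*} [Fintype n] [DecidableEq n]

theorem Matrix.eq_zero_of_pow_mul_eq_zero {M R : Matrix n n ℝ} (hM : Mᵀ = M) (k : ℕ)
    (h : M ^ k * R = 0) : M * R = 0 := by
  induction k with
  | zero => rw [pow_zero, Matrix.one_mul] at h; rw [h, Matrix.mul_zero]
  | succ k ih =>
    cases k with
    | zero => simpa using h
    | succ k =>
      apply ih
      have hT : (M ^ (k + 1))ᵀ = M ^ (k + 1) := by rw [transpose_pow, hM]
      -- By symmetry the Gram matrix of M^(k+1) R is Rᵀ M^(2k+2) R, which contains the vanishing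
      -- factor M^(k+2) R. A real matrix with zero Gram matrix is zero.
      have h0 : (M ^ (k + 1) * R)ᵀ * (M ^ (k + 1) * R) = 0 := by
        rw [transpose_mul, hT, Matrix.mul_assoc, ← Matrix.mul_assoc (M ^ (k + 1)), ← pow_add,
          show k + 1 + (k + 1) = k + (k + 1 + 1) by omega, pow_add, Matrix.mul_assoc (M ^ k), h,
          Matrix.mul_zero, Matrix.mul_zero]
      have := Matrix.conjTranspose_mul_self_eq_zero (A := M ^ (k + 1) * R)
      rw [conjTranspose_eq_transpose_of_trivial] at this
      exact this.mp h0

/-- A symmetric matrix is diagonalizable, so the dimension of its kernel is the multiplicity of 0 as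
a root of the characteristic polynomial. Bounds on it thus become polynomial equations in the
entries. -/
theorem Matrix.le_finrank_ker_iff {M : Matrix n n ℝ} (hM : Mᵀ = M) (k : ℕ) :
    k ≤ Module.finrank ℝ (LinearMap.ker (toLin' M)) ↔ ∀ l < k, M.charpoly.coeff l = 0 := by
  have hH : M.IsHermitian := by
    rw [Matrix.IsHermitian, conjTranspose_eq_transpose_of_trivial, hM]
  rw [← Polynomial.X_pow_dvd_iff, ← sub_zero (Polynomial.X), ← map_zero Polynomial.C,
    ← Polynomial.le_rootMultiplicity_iff (charpoly_monic M).ne_zero, ← Polynomial.count_roots,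
    hH.roots_charpoly_eq_eigenvalues, Multiset.count_map]
  have h1 := LinearMap.finrank_range_add_finrank_ker (toLin' M)
  have h2 : Module.finrank ℝ (LinearMap.range (toLin' M)) = M.rank := rfl
  rw [h2, hH.rank_eq_card_non_zero_eigs, Module.finrank_fintype_fun_eq_card,
    Fintype.card_subtype] at h1
  have h3 := Finset.card_filter_add_card_filter_not (s := Finset.univ)
    (fun i => hH.eigenvalues i = 0)
  simp only [eq_comm (a := (0 : ℝ))]
  have h4 : (Multiset.filter (fun x => (RCLike.ofReal ∘ hH.eigenvalues) x = (0 : ℝ))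
      Finset.univ.val).card = (Finset.univ.filter fun i => hH.eigenvalues i = 0).card := rfl
  rw [h4]
  rw [Finset.card_univ] at h3
  have h5 : (Finset.univ.filter fun i => hH.eigenvalues i ≠ 0).card =
    (Finset.univ.filter fun i => ¬ hH.eigenvalues i = 0).card := rfl
  omega

/-- The value at `M` of the quotient by `X ^ k` of the characteristic polynomial of `M`. If `M` is
a real symmetric matrix and its kernel has dimension `k`, then this is a multiple of the matrix of
the orthogonal projection onto that kernel. -/
noncomputable def Matrix.charpolyShift {R : Type*} [CommRing R] (M : Matrix n n R) (k : ℕ) :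
    Matrix n n R :=
  ∑ j ∈ Finset.range (Fintype.card n + 1), M.charpoly.coeff (j + k) • M ^ j

theorem Matrix.charpolyShift_map {R S : Type*} [CommRing R] [CommRing S] (M : Matrix n n R) (k : ℕ)
    (f : R →+* S) : (M.charpolyShift k).map f = (M.map f).charpolyShift k := by
  have h : ∀ A : Matrix n n R, A.map f = f.mapMatrix A := fun _ => rfl
  rw [charpolyShift, charpolyShift, h, h, map_sum]
  refine Finset.sum_congr rfl fun j _ => ?_
  rw [← map_pow, ← h M, charpoly_map, Polynomial.coeff_map]
  ext
  simp

/-- Write the characteristic polynomial as X^k q with q(0) ≠ 0. Then R = q(M) is symmetric, killed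
by M, and acts on ker M as the scalar q(0). -/
theorem Matrix.charpolyShift_spec {M : Matrix n n ℝ} (hM : Mᵀ = M) {k : ℕ}
    (h : Module.finrank ℝ (LinearMap.ker (toLin' M)) = k) :
    M.charpoly.coeff k ≠ 0 ∧ ((M.charpoly.coeff k)⁻¹ • M.charpolyShift k).IsOrthProj ∧
      LinearMap.range (toLin' ((M.charpoly.coeff k)⁻¹ • M.charpolyShift k)) = LinearMap.ker (toLin' M) := by
  set q := Polynomial.divX^[k] M.charpoly with hq
  have hcoeff : ∀ j, q.coeff j = M.charpoly.coeff (j + k) := by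
    intro j
    rw [hq]
    clear_value q
    clear hq h
    induction k generalizing j with
    | zero => rfl
    | succ k ih =>
      rw [Function.iterate_succ_apply', Polynomial.coeff_divX, ih]
      congr 1
      omega
  have hR : M.charpolyShift k = Polynomial.aeval M q := by
    have hdeg : q.natDegree < Fintype.card n + 1 := by
      rw [Nat.lt_succ_iff, Polynomial.natDegree_le_iff_coeff_eq_zero]
      intro N hN
      rw [hcoeff]
      apply Polynomial.coeff_eq_zero_of_natDegree_lt
      rw [charpoly_natDegree_eq_dim]
      omega
    rw [Polynomial.aeval_eq_sum_range' hdeg, charpolyShift]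
    simp only [hcoeff]
  set R := M.charpolyShift k
  have hlow := (le_finrank_ker_iff hM k).mp h.ge
  have hk : M.charpoly.coeff k ≠ 0 := by
    intro h0
    have : k + 1 ≤ Module.finrank ℝ (LinearMap.ker (toLin' M)) := by
      rw [le_finrank_ker_iff hM]
      intro l hl
      rcases Nat.lt_succ_iff_lt_or_eq.mp hl with hl | rfl
      exacts [hlow l hl, h0]
    omega
  -- Cayley–Hamilton gives M^k R = 0, and symmetry removes the exponent.
  have hMR : M * R = 0 := by
    apply eq_zero_of_pow_mul_eq_zero hM k
    have : Polynomial.X ^ k * q = M.charpoly := by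
      ext j
      rw [Polynomial.coeff_X_pow_mul']
      split_ifs with hj
      · rw [hcoeff, Nat.sub_add_cancel hj]
      · exact (hlow j (by omega)).symm
    have h1 := congrArg (Polynomial.aeval M) this
    rwa [map_mul, map_pow, Polynomial.aeval_X, Matrix.aeval_self_charpoly, ← hR] at h1
  have hRT : Rᵀ = R := by
    rw [hR, Polynomial.aeval_eq_sum_range, transpose_sum]
    simp [transpose_pow, hM]
  -- Splitting off the constant term of q gives R = TM + q(0). With MR = 0 this yields R² = q(0) R.
  obtain ⟨T, hT⟩ : ∃ T, R = T * M + M.charpoly.coeff k • 1 := by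
    refine ⟨Polynomial.aeval M q.divX, ?_⟩
    have := congrArg (Polynomial.aeval M) (Polynomial.divX_mul_X_add q)
    rw [map_add, map_mul, Polynomial.aeval_X, Polynomial.aeval_C, hcoeff, zero_add,
      Algebra.algebraMap_eq_smul_one] at this
    rw [hR, this]
  have hP : ((M.charpoly.coeff k)⁻¹ • R).IsOrthProj := by
    refine ⟨by rw [transpose_smul, hRT], ?_⟩
    have : R * R = M.charpoly.coeff k • R := by
      nth_rw 1 [hT]
      rw [Matrix.add_mul, Matrix.mul_assoc, hMR, Matrix.mul_zero, zero_add, Matrix.smul_mul,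
        Matrix.one_mul]
    rw [Matrix.smul_mul, Matrix.mul_smul, this, smul_smul (_)⁻¹ _ R,
      inv_mul_cancel₀ hk, one_smul]
  refine ⟨hk, hP, ?_⟩
  ext v
  rw [hP.mem_range_iff, LinearMap.mem_ker, toLin'_apply]
  constructor
  · intro hv
    rw [← hv, mulVec_mulVec, Matrix.mul_smul, hMR, smul_zero, zero_mulVec]
  · intro hv
    rw [smul_mulVec, hT, Matrix.add_mulVec, ← mulVec_mulVec, hv, mulVec_zero,
      zero_add, smul_mulVec, one_mulVec, smul_smul, inv_mul_cancel₀ hk, one_smul]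

end Kernel

/-! ### Projections onto spans of columns, by Cramer's rule. -/

section Gram

variable {n J : Type*} [Fintype n] [Fintype J] [DecidableEq J]

/-- If the columns of `B` are linearly independent, then this is `det (Bᵀ B)` times the matrix of
the orthogonal projection onto their span. -/
def Matrix.gramAdj {R : Type*} [CommRing R] (B : Matrix n J R) : Matrix n n R :=
  B * (Bᵀ * B).adjugate * Bᵀ

/-- The Gram determinant of the columns of `B`. -/
def Matrix.gramDet {R : Type*} [CommRing R] (B : Matrix n J R) : R := (Bᵀ * B).det

theorem Matrix.gramDet_map {R S : Type*} [CommRing R] [CommRing S] (B : Matrix n J R)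
    (f : R →+* S) : f B.gramDet = (B.map f).gramDet := by
  rw [gramDet, gramDet, RingHom.map_det, RingHom.mapMatrix_apply, Matrix.map_mul, transpose_map]

theorem Matrix.gramAdj_map {R S : Type*} [CommRing R] [CommRing S] (B : Matrix n J R)
    (f : R →+* S) : B.gramAdj.map f = (B.map f).gramAdj := by
  rw [gramAdj, gramAdj, Matrix.map_mul, Matrix.map_mul, ← RingHom.mapMatrix_apply f (adjugate _),
    RingHom.map_adjugate, RingHom.mapMatrix_apply, Matrix.map_mul, transpose_map]

/-- The matrix of the orthogonal projection onto the span of the columns of `B`, provided these are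
linearly independent. -/
noncomputable def Matrix.spanProj (B : Matrix n J ℝ) : Matrix n n ℝ :=
  B.gramDet⁻¹ • B.gramAdj

theorem Matrix.spanProj_eq (B : Matrix n J ℝ) : B.spanProj = B * (Bᵀ * B)⁻¹ * Bᵀ := by
  rw [spanProj, gramAdj, gramDet, Matrix.inv_def, Ring.inverse_eq_inv', Matrix.mul_smul,
    Matrix.smul_mul]

theorem Matrix.spanProj_mul {B : Matrix n J ℝ} (hB : B.gramDet ≠ 0) : B.spanProj * B = B := by
  rw [spanProj_eq, Matrix.mul_assoc, Matrix.mul_assoc, Matrix.nonsing_inv_mul _ hB.isUnit,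
    Matrix.mul_one]

theorem Matrix.spanProj_isOrthProj {B : Matrix n J ℝ} (hB : B.gramDet ≠ 0) :
    B.spanProj.IsOrthProj := by
  constructor
  · rw [spanProj_eq, transpose_mul, transpose_mul, transpose_transpose, transpose_nonsing_inv,
      transpose_mul, transpose_transpose, Matrix.mul_assoc]
  · nth_rw 2 [spanProj_eq]
    rw [← Matrix.mul_assoc, ← Matrix.mul_assoc, spanProj_mul hB, ← spanProj_eq]

theorem Matrix.trace_spanProj {B : Matrix n J ℝ} (hB : B.gramDet ≠ 0) :
    B.spanProj.trace = Fintype.card J := by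
  rw [spanProj_eq, trace_mul_comm, ← Matrix.mul_assoc, Matrix.mul_nonsing_inv _ hB.isUnit,
    trace_one]

theorem Matrix.mul_spanProj {Q : Matrix n n ℝ} {B : Matrix n J ℝ} (h : Q * B = B) :
    Q * B.spanProj = B.spanProj := by
  rw [spanProj_eq, ← Matrix.mul_assoc, ← Matrix.mul_assoc, h]

theorem Matrix.gramDet_of_orthonormal {C : Matrix n J ℝ} (hC : Cᵀ * C = 1) : C.gramDet = 1 := by
  rw [gramDet, hC, det_one]

theorem Matrix.spanProj_of_orthonormal {C : Matrix n J ℝ} (hC : Cᵀ * C = 1) :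
    C.spanProj = C * Cᵀ := by
  rw [spanProj_eq, hC, inv_one, Matrix.mul_one]

end Gram

/-- With U and V orthonormal bases of the ranges of P and Q, the p × q matrix UᵀCV determines C =
UUᵀ C VVᵀ. -/
theorem Matrix.finrank_sandwich_le {n : Type*} [Fintype n] [DecidableEq n] {P Q : Matrix n n ℝ}
    (hP : P.IsOrthProj) (hQ : Q.IsOrthProj) (S : Submodule ℝ (Matrix n n ℝ))
    (hS : ∀ C ∈ S, P * C = C ∧ C * Q = C) {p q : ℕ} (hp : P.trace = p) (hq : Q.trace = q) :
    Module.finrank ℝ S ≤ p * q := by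
  obtain ⟨U, hU, hU'⟩ := Submodule.exists_orthonormal_matrix (LinearMap.range (toLin' P)) (r := p)
    (by exact_mod_cast hP.trace_eq_finrank.symm.trans hp)
  obtain ⟨V, hV, hV'⟩ := Submodule.exists_orthonormal_matrix (LinearMap.range (toLin' Q)) (r := q)
    (by exact_mod_cast hQ.trace_eq_finrank.symm.trans hq)
  have hPU := (Matrix.IsOrthProj.of_mul_transpose hU).eq_of_range_eq hP hU'
  have hQV := (Matrix.IsOrthProj.of_mul_transpose hV).eq_of_range_eq hQ hV'
  let f : S →ₗ[ℝ] Matrix (Fin p) (Fin q) ℝ :=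
    { toFun := fun C => Uᵀ * C.1 * V
      map_add' := fun C C' => by simp [Matrix.mul_add, Matrix.add_mul]
      map_smul' := fun c C => by simp }
  have hf : Function.Injective f := by
    rw [injective_iff_map_eq_zero]
    intro C hC
    have h1 : Uᵀ * C.1 * V = 0 := hC
    obtain ⟨h2, h3⟩ := hS C.1 C.2
    ext1
    rw [← h2, ← h3, ← hPU, ← hQV]
    rw [show U * Uᵀ * (C.1 * (V * Vᵀ)) = U * (Uᵀ * C.1 * V) * Vᵀ by simp only [Matrix.mul_assoc], h1]
    simp
  refine (LinearMap.finrank_le_finrank_of_injective hf).trans ?_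
  simp [Module.finrank_matrix]

namespace Matrix.IsOrthProj

variable {n : Type*} [Fintype n] [DecidableEq n] {X D : Matrix n n ℝ}

theorem of_one_sub (hX : X.IsOrthProj) : (1 - X).IsOrthProj := by
  refine ⟨by rw [transpose_sub, transpose_one, hX.symm], ?_⟩
  rw [sub_mul, mul_sub, mul_sub, hX.idem]
  simp

theorem exists_orthonormal (hX : X.IsOrthProj) {r : ℕ} (hr : X.trace = r) :
    ∃ C : Matrix n (Fin r) ℝ, Cᵀ * C = 1 ∧ C * Cᵀ = X := by
  obtain ⟨C, hC, hC'⟩ := Submodule.exists_orthonormal_matrix (LinearMap.range (toLin' X)) (r := r)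
    (by exact_mod_cast hX.trace_eq_finrank.symm.trans hr)
  exact ⟨C, hC, (of_mul_transpose hC).eq_of_range_eq hX hC'⟩

theorem trace_eq_iff (hX : X.IsOrthProj) {r : ℕ} :
    X.trace = r ↔ Module.finrank ℝ (LinearMap.range (toLin' X)) = r := by
  rw [hX.trace_eq_finrank]
  norm_cast

/-- A symmetric matrix whose kernel is the intersection of the ranges of the orthogonal
projections `X` and `D`. -/
def _root_.Matrix.interMatrix {R : Type*} [CommRing R] (X D : Matrix n n R) : Matrix n n R :=
  D * (1 - X) * D + (1 - D)

theorem interMatrix_symm (hX : X.IsOrthProj) (hD : D.IsOrthProj) :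
    (interMatrix X D)ᵀ = interMatrix X D := by
  simp [interMatrix, transpose_mul, hX.symm, hD.symm, Matrix.mul_assoc]

/-- The quadratic form of this matrix at v is |(1 - X)Dv|² + |(1 - D)v|², which vanishes only if Dv
= v and Xv = v. -/
theorem ker_interMatrix (hX : X.IsOrthProj) (hD : D.IsOrthProj) :
    LinearMap.ker (toLin' (interMatrix X D)) =
      LinearMap.range (toLin' X) ⊓ LinearMap.range (toLin' D) := by
  ext v
  rw [Submodule.mem_inf, hX.mem_range_iff, hD.mem_range_iff, LinearMap.mem_ker, toLin'_apply]
  constructor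
  · intro h
    have h1 : (1 - X) *ᵥ (D *ᵥ v) ⬝ᵥ ((1 - X) *ᵥ (D *ᵥ v)) +
        ((1 - D) *ᵥ v) ⬝ᵥ ((1 - D) *ᵥ v) = 0 := by
      rw [← hX.of_one_sub.dotProduct_mulVec_self, ← hD.of_one_sub.dotProduct_mulVec_self]
      have : (D *ᵥ v) ⬝ᵥ (1 - X) *ᵥ D *ᵥ v = v ⬝ᵥ (D * (1 - X) * D) *ᵥ v := by
        have hv : D *ᵥ v = v ᵥ* D := by rw [← mulVec_transpose, hD.symm]
        nth_rw 1 [hv]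
        rw [← dotProduct_mulVec, mulVec_mulVec, mulVec_mulVec, Matrix.mul_assoc]
      rw [this, ← dotProduct_add, ← add_mulVec]
      change v ⬝ᵥ (interMatrix X D *ᵥ v) = 0
      rw [h, dotProduct_zero]
    have h2 : ∀ w : n → ℝ, 0 ≤ w ⬝ᵥ w := fun w => Finset.sum_nonneg fun i _ => mul_self_nonneg _
    have h3 := dotProduct_self_eq_zero.mp
      (le_antisymm (by linarith [h2 ((1 - X) *ᵥ (D *ᵥ v))]) (h2 ((1 - D) *ᵥ v)))
    have h4 := dotProduct_self_eq_zero.mp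
      (le_antisymm (by linarith [h2 ((1 - D) *ᵥ v)]) (h2 ((1 - X) *ᵥ (D *ᵥ v))))
    rw [sub_mulVec, one_mulVec, sub_eq_zero] at h3 h4
    rw [← h3] at h4
    exact ⟨h4.symm, h3.symm⟩
  · rintro ⟨h1, h2⟩
    simp [interMatrix, add_mulVec, ← mulVec_mulVec, h2, sub_mulVec, h1]

end Matrix.IsOrthProj

end

/-! ### Indices, the canonical flag, and points of Z as sequences of matrices. -/

section

open Matrix

namespace Schubert

section Indices

variable (a b : ℕ → ℕ)

@[simp] theorem mIdx_zero : mIdx a 0 = 0 := by simp [mIdx]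

theorem mIdx_succ (k : ℕ) : mIdx a (k + 1) = mIdx a k + a (k + 1) := by
  rw [mIdx, mIdx, Finset.sum_Icc_succ_top (by omega)]

theorem dIdx_eq (k : ℕ) : dIdx a b k = mIdx a k + ∑ i ∈ Finset.range k, b i := by
  rw [dIdx]
  congr 1
  induction k with
  | zero => simp
  | succ k ih => rw [Finset.sum_Icc_succ_top (by omega), ih, Finset.sum_range_succ]; simp

theorem dIdx_succ (k : ℕ) : dIdx a b (k + 1) = dIdx a b k + b k + a (k + 1) := by
  rw [dIdx_eq, dIdx_eq, mIdx_succ, Finset.sum_range_succ]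
  ring

theorem dIdx_mono : Monotone (dIdx a b) :=
  monotone_nat_of_le_succ fun k => by rw [dIdx_succ]; omega

theorem mIdx_mono : Monotone (mIdx a) :=
  monotone_nat_of_le_succ fun k => by rw [mIdx_succ]; omega

variable {a b} {m n c : ℕ} {lam : Fin m → ℕ}

theorem IsStaircase.mIdx_eq (h : IsStaircase n lam c a b) : mIdx a c = m := h.sum_a

theorem IsStaircase.dIdx_eq (h : IsStaircase n lam c a b) : dIdx a b c = m + n := by
  rw [Schubert.dIdx_eq, h.mIdx_eq, h.sum_b]

theorem IsStaircase.dIdx_le (h : IsStaircase n lam c a b) {k : ℕ} (hk : k ≤ c) :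
    dIdx a b k ≤ m + n := h.dIdx_eq ▸ dIdx_mono a b hk

end Indices

section Flag

theorem D_isOrthProj (N d : ℕ) : (D N d).IsOrthProj := by
  refine ⟨diagonal_transpose _, ?_⟩
  rw [D, diagonal_mul_diagonal]
  congr 1
  ext i
  split_ifs <;> simp

theorem D_mulVec_eq_iff {N d : ℕ} (v : Fin N → ℝ) :
    D N d *ᵥ v = v ↔ ∀ i : Fin N, d ≤ (i : ℕ) → v i = 0 := by
  rw [funext_iff]
  refine forall_congr' fun i => ?_
  rw [D, mulVec_diagonal]
  split_ifs with h
  · simp [h]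
  · simp only [zero_mul, not_lt.mp h, true_implies]
    exact eq_comm

theorem flag_eq (N d : ℕ) : flag N d = LinearMap.range (toLin' (D N d)) := by
  apply le_antisymm
  · rw [flag, Submodule.span_le]
    rintro _ ⟨i, hi, rfl⟩
    rw [SetLike.mem_coe, (D_isOrthProj N d).mem_range_iff, D_mulVec_eq_iff]
    intro j hj
    rw [Pi.single_eq_of_ne]
    rintro rfl
    omega
  · intro v hv
    rw [(D_isOrthProj N d).mem_range_iff, D_mulVec_eq_iff] at hv
    rw [pi_eq_sum_univ' v]
    refine Submodule.sum_mem _ fun i _ => ?_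
    by_cases hi : (i : ℕ) < d
    · exact Submodule.smul_mem _ _ (Submodule.subset_span ⟨i, hi, by
        ext j; simp [Pi.single_apply, eq_comm]⟩)
    · rw [hv i (not_lt.mp hi), zero_smul]
      exact Submodule.zero_mem _

theorem trace_D {N d : ℕ} (h : d ≤ N) : (D N d).trace = d := by
  rw [D, trace_diagonal, Finset.sum_ite, Finset.sum_const_zero, add_zero, Finset.sum_const,
    nsmul_eq_mul, mul_one]
  congr 1
  have : (Finset.univ.filter fun i : Fin N => (i : ℕ) < d) =
      Finset.univ.map (Fin.castLEEmb h) := by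
    ext i
    simp only [Finset.mem_filter, Finset.mem_univ, true_and, Finset.mem_map]
    constructor
    · intro hi
      exact ⟨⟨i, hi⟩, rfl⟩
    · rintro ⟨j, rfl⟩
      exact j.2
  rw [this, Finset.card_map, Finset.card_univ, Fintype.card_fin]

theorem D_eq_one {N d : ℕ} (h : N ≤ d) : D N d = 1 := by
  rw [D, ← diagonal_one]
  congr 1
  ext i
  rw [if_pos (i.2.trans_le h)]

end Flag

section Blocks

/-- The coordinates of the ambient space of a Bott–Samelson set. -/
abbrev Coord (N c : ℕ) := (Fin N × Fin N) ⊕ (Fin (c - 1) × (Fin N × Fin N))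

variable {N c : ℕ} {R S : Type*} [Zero R] [Zero S]

/-- The matrices `0, Y_1, …, Y_{c-1}, X` of a point of the ambient space of a Bott–Samelson set. -/
def block (x : Coord N c → R) (i : ℕ) : Matrix (Fin N) (Fin N) R :=
  if i = 0 then 0 else
    if h : i - 1 < c - 1 then Matrix.of fun p r => x (Sum.inr (⟨i - 1, h⟩, (p, r)))
    else Matrix.of fun p r => x (Sum.inl (p, r))

/-- The point with given matrices `Y_1, …, Y_{c-1}, Y_c = X`. -/
def ofBlocks {R : Type*} (c : ℕ) (Y : ℕ → Matrix (Fin N) (Fin N) R) : Coord N c → R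
  | Sum.inl s => Y c s.1 s.2
  | Sum.inr (i, s) => Y (i + 1) s.1 s.2

theorem ofBlocks_congr {R : Type*} (hc : 1 ≤ c)
    {Y Y' : ℕ → Matrix (Fin N) (Fin N) R}
    (h : ∀ i < c, Y (i + 1) = Y' (i + 1)) : ofBlocks c Y = ofBlocks c Y' := by
  ext (s | ⟨i, s⟩)
  · have := h (c - 1) (by omega)
    rw [Nat.sub_add_cancel hc] at this
    rw [ofBlocks, ofBlocks, this]
  · rw [ofBlocks, ofBlocks, h i (by omega)]

theorem block_map (x : Coord N c → R) (f : R → S) (hf : f 0 = 0) (i : ℕ) :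
    (block x i).map f = block (fun s => f (x s)) i := by
  rw [block, block]
  split_ifs
  · ext; simp [hf]
  · rfl
  · rfl

theorem block_zero (x : Coord N c → R) : block x 0 = 0 := if_pos rfl

theorem block_last (hc : 1 ≤ c) (x : Coord N c → R) :
    block x c = Matrix.of fun p r => x (Sum.inl (p, r)) := by
  rw [block, if_neg (by omega), dif_neg (by omega)]

theorem block_succ (x : Coord N c → R) (i : Fin (c - 1)) :
    block x (i + 1) = Matrix.of fun p r => x (Sum.inr (i, (p, r))) := by
  rw [block, if_neg (by omega), dif_pos (by simp)]
  simp

theorem block_ofBlocks (hc : 1 ≤ c) (Y : ℕ → Matrix (Fin N) (Fin N) R) {i : ℕ} (hi : i < c) :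
    block (ofBlocks c Y) (i + 1) = Y (i + 1) := by
  rcases Nat.lt_or_ge i (c - 1) with h | h
  · rw [show i + 1 = ((⟨i, h⟩ : Fin (c - 1)) : ℕ) + 1 from rfl, block_succ]
    rfl
  · obtain rfl : c = i + 1 := by omega
    rw [block_last hc]
    rfl

theorem ofBlocks_block (hc : 1 ≤ c) (x : Coord N c → R) : ofBlocks c (block x) = x := by
  ext (s | ⟨i, s⟩)
  · rw [ofBlocks, block_last hc]
    rfl
  · rw [ofBlocks, block_succ]
    rfl

/-- Treating X as Y_c and setting Y_0 = 0 makes the conditions uniform in i: the added equations are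
void because D_{d_c} = 1 and Y_1 Y_0 = 0. -/
theorem mem_bottSamelson_iff {m n : ℕ} {lam : Fin m → ℕ} {a b : ℕ → ℕ}
    (h : IsStaircase n lam c a b) (x : Coord (m + n) c → ℝ) :
    x ∈ bottSamelson m n c a b ↔ ∀ i < c, (block x (i + 1)).IsOrthProj ∧
      (block x (i + 1)).trace = mIdx a (i + 1) ∧
      block x (i + 1) * D (m + n) (dIdx a b (i + 1)) = block x (i + 1) ∧
      block x (i + 1) * block x i = block x i := by
  have hc := h.c_pos
  have hY : ∀ i : Fin (c - 1), toMatrix (fun s => x (Sum.inr (i, s))) = block x (i + 1) :=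
    fun i => (block_succ x i).symm
  have hX : toMatrix (fun s => x (Sum.inl s)) = block x c := (block_last hc x).symm
  constructor
  · rintro ⟨X, Y, rfl, hY', hG, hYG, hD, hYY, hXY⟩ i hi
    simp only [hY'] at hYG hD hYY hXY
    simp only [hY] at hYG hD hYY hXY
    rw [hX] at hG hXY
    rcases Nat.lt_or_ge i (c - 1) with hi' | hi'
    · refine ⟨⟨(hYG ⟨i, hi'⟩).1, (hYG ⟨i, hi'⟩).2.1⟩, (hYG ⟨i, hi'⟩).2.2, hD ⟨i, hi'⟩, ?_⟩
      rcases Nat.eq_zero_or_pos i with rfl | hi0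
      · rw [block_zero, Matrix.mul_zero]
      · have := hYY ⟨i - 1, by omega⟩ ⟨i, hi'⟩ (by simp; omega)
        simpa [Nat.sub_add_cancel hi0] using this
    · obtain rfl : c = i + 1 := by omega
      refine ⟨⟨hG.1, hG.2.1⟩, by rw [hG.2.2, h.mIdx_eq], ?_, ?_⟩
      · rw [D_eq_one h.dIdx_eq.ge, Matrix.mul_one]
      · rcases Nat.eq_zero_or_pos i with rfl | hi0
        · rw [block_zero, Matrix.mul_zero]
        · have := hXY ⟨i - 1, by omega⟩ (by simp; omega)
          simpa [Nat.sub_add_cancel hi0] using this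
  · intro H
    refine ⟨_, _, rfl, fun i => rfl, ?_, ?_, ?_, ?_, ?_⟩
    · rw [hX]
      have := H (c - 1) (by omega)
      rw [Nat.sub_add_cancel hc] at this
      exact ⟨this.1.symm, this.1.idem, by rw [this.2.1, h.mIdx_eq]⟩
    · intro i
      rw [hY]
      have := H i (by omega)
      exact ⟨this.1.symm, this.1.idem, this.2.1⟩
    · intro i
      rw [hY]
      exact (H i (by omega)).2.2.1
    · intro i j hij
      rw [hY, hY, hij]
      exact (H (i + 1) (by omega)).2.2.2
    · intro i hi
      rw [hX, hY]
      have := (H (c - 1) (by omega)).2.2.2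
      rw [Nat.sub_add_cancel hc, ← hi] at this
      exact this

end Blocks

end Schubert

end

/-! ### Equations of Z and the bound on its tangent spaces. -/

section

open Matrix

namespace RealAlg

theorem isAlgebraicSet_setOf_map_eq_zero {σ K L n p : Type*} [Field K] [Field L] [Algebra K L]
    (A : Matrix n p (MvPolynomial σ K)) :
    IsAlgebraicSet K {x : σ → L | A.map (MvPolynomial.aeval x) = 0} := by
  convert isAlgebraicSet_setOf_aeval_eq_zero (L := L) (fun s : n × p => A s.1 s.2) using 1
  ext x
  simp [← Matrix.ext_iff]

variable {σ n : Type*} [Fintype σ]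

theorem differential_mul (a v : σ → ℝ) (f g : MvPolynomial σ ℝ) :
    differential a (f * g) v =
      differential a f v * MvPolynomial.eval a g + MvPolynomial.eval a f * differential a g v := by
  simp only [differential_apply, Derivation.leibniz, smul_eq_mul, map_add, map_mul,
    Finset.sum_mul, Finset.mul_sum, ← Finset.sum_add_distrib]
  refine Finset.sum_congr rfl fun i _ => ?_
  ring

theorem differential_X (a v : σ → ℝ) (s : σ) :
    differential a (MvPolynomial.X s) v = v s := by
  classical
  rw [differential_apply, Finset.sum_eq_single s]
  · simp
  · intro j _ hj
    simp [MvPolynomial.pderiv_X, hj.symm]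
  · simp

/-- The derivative at `a` in the direction `v` of a matrix of polynomials. -/
noncomputable def matrixDeriv {p : Type*} (a v : σ → ℝ) (A : Matrix n p (MvPolynomial σ ℝ)) :
    Matrix n p ℝ := A.map fun f => differential a f v

theorem matrixDeriv_mul [Fintype n] (a v : σ → ℝ) (A B : Matrix n n (MvPolynomial σ ℝ)) :
    matrixDeriv a v (A * B) = matrixDeriv a v A * B.map (MvPolynomial.eval a) +
      A.map (MvPolynomial.eval a) * matrixDeriv a v B := by
  ext i j
  simp [matrixDeriv, Matrix.mul_apply, map_sum, LinearMap.sum_apply, differential_mul,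
    Finset.sum_add_distrib]

theorem matrixDeriv_sub {p : Type*} (a v : σ → ℝ) (A B : Matrix n p (MvPolynomial σ ℝ)) :
    matrixDeriv a v (A - B) = matrixDeriv a v A - matrixDeriv a v B := by
  ext i j
  simp [matrixDeriv]

theorem matrixDeriv_eq_zero {p : Type*} {V : Set (σ → ℝ)} {a v : σ → ℝ} (hv : v ∈ tangentSpace V a)
    {A : Matrix n p (MvPolynomial σ ℝ)} (hA : ∀ x ∈ V, A.map (MvPolynomial.eval x) = 0) :
    matrixDeriv a v A = 0 := by
  ext i j
  refine (mem_tangentSpace.mp hv) _ fun x hx => ?_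
  have := congrFun (congrFun (hA x hx) i) j
  simpa [MvPolynomial.aeval_eq_eval] using this

theorem matrixDeriv_C {p : Type*} (a v : σ → ℝ) (A : Matrix n p ℝ) :
    matrixDeriv a v (A.map MvPolynomial.C) = 0 := by
  ext i j
  simp [matrixDeriv, differential_apply]

end RealAlg

namespace Schubert

open RealAlg

variable {m n c : ℕ} {lam : Fin m → ℕ} {a b : ℕ → ℕ}

/-- The generic block. -/
noncomputable def genBlock (N c i : ℕ) : Matrix (Fin N) (Fin N) (MvPolynomial (Coord N c) ℝ) :=
  block MvPolynomial.X i

theorem genBlock_map {N : ℕ} (x : Coord N c → ℝ) (i : ℕ) :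
    (genBlock N c i).map (MvPolynomial.eval x) = block x i := by
  rw [genBlock, block_map _ _ (map_zero _)]
  simp

theorem matrixDeriv_genBlock {N : ℕ} (x v : Coord N c → ℝ) (i : ℕ) :
    matrixDeriv x v (genBlock N c i) = block v i := by
  rw [genBlock, matrixDeriv, block_map _ _ (by simp)]
  simp [differential_X]

theorem matrixDeriv_genBlock_transpose {N : ℕ} (x v : Coord N c → ℝ) (i : ℕ) :
    matrixDeriv x v (genBlock N c i)ᵀ = (block v i)ᵀ := by
  rw [← matrixDeriv_genBlock x v]
  rfl

theorem isAlgebraicSet_bottSamelson (h : IsStaircase n lam c a b) :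
    IsAlgebraicSet ℝ (bottSamelson m n c a b) := by
  let Y := genBlock (m + n) c
  let Dm : ℕ → Matrix (Fin (m + n)) (Fin (m + n)) (MvPolynomial (Coord (m + n) c) ℝ) := fun i =>
    (D (m + n) (dIdx a b i)).map MvPolynomial.C
  have hD : ∀ (i : ℕ) (x : Coord (m + n) c → ℝ), (Dm i).map (MvPolynomial.eval x) =
      D (m + n) (dIdx a b i) := by
    intro i x
    ext
    simp [Dm]
  have : bottSamelson m n c a b = ⋂ i : Fin c,
      ({x | ((Y (i + 1))ᵀ - Y (i + 1)).map (MvPolynomial.aeval x) = 0} ∩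
      {x | (Y (i + 1) * Y (i + 1) - Y (i + 1)).map (MvPolynomial.aeval x) = 0}) ∩
      ({x | ∀ _ : Unit, MvPolynomial.aeval x
        ((Y (i + 1)).trace - MvPolynomial.C (mIdx a (i + 1) : ℝ)) = 0} ∩
      ({x | (Y (i + 1) * Dm (i + 1) - Y (i + 1)).map (MvPolynomial.aeval x) = 0} ∩
      {x | (Y (i + 1) * Y i - Y i).map (MvPolynomial.aeval x) = 0})) := by
    ext x
    rw [mem_bottSamelson_iff h]
    simp only [Set.mem_iInter, Set.mem_inter_iff, Set.mem_ofPred_eq, MvPolynomial.aeval_eq_eval,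
      Matrix.map_sub _ (map_sub _), Matrix.map_mul, transpose_map, genBlock_map, hD, Y,
      sub_eq_zero, forall_const, map_sub, MvPolynomial.eval_C]
    have ht : ∀ i, MvPolynomial.eval x (genBlock (m + n) c i).trace = (block x i).trace := by
      intro i
      rw [← genBlock_map, ← AddMonoidHom.map_trace]
    simp only [ht]
    constructor
    · intro H i
      obtain ⟨h1, h2, h3, h4⟩ := H i i.2
      exact ⟨⟨h1.symm, h1.idem⟩, h2, h3, h4⟩
    · intro H i hi
      obtain ⟨⟨h1, h1'⟩, h2, h3, h4⟩ := H ⟨i, hi⟩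
      exact ⟨⟨h1, h1'⟩, h2, h3, h4⟩
  rw [this]
  exact IsAlgebraicSet.iInter fun i => .inter
    (.inter (isAlgebraicSet_setOf_map_eq_zero _) (isAlgebraicSet_setOf_map_eq_zero _))
    (.inter (isAlgebraicSet_setOf_aeval_eq_zero _) (.inter (isAlgebraicSet_setOf_map_eq_zero _)
      (isAlgebraicSet_setOf_map_eq_zero _)))

/-- The linearized equations of a Bott–Samelson set. -/
theorem block_of_mem_tangentSpace (h : IsStaircase n lam c a b) {x v : Coord (m + n) c → ℝ}
    (hv : v ∈ tangentSpace (bottSamelson m n c a b) x) {i : ℕ} (hi : i < c) :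
    (block v (i + 1))ᵀ = block v (i + 1) ∧
    block v (i + 1) * block x (i + 1) + block x (i + 1) * block v (i + 1) = block v (i + 1) ∧
    block v (i + 1) * D (m + n) (dIdx a b (i + 1)) = block v (i + 1) ∧
    block v (i + 1) * block x i + block x (i + 1) * block v i = block v i := by
  have hZ := fun x => (mem_bottSamelson_iff h x).mp
  have hsub : ∀ (x : Coord (m + n) c → ℝ) (A B : Matrix (Fin (m + n)) (Fin (m + n))
      (MvPolynomial (Coord (m + n) c) ℝ)), (A - B).map (MvPolynomial.eval x) =
      A.map (MvPolynomial.eval x) - B.map (MvPolynomial.eval x) :=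
    fun x A B => Matrix.map_sub _ (map_sub _) _ _
  have hD : ∀ x : Coord (m + n) c → ℝ, ((D (m + n) (dIdx a b (i + 1))).map MvPolynomial.C).map
      (MvPolynomial.eval x) = D (m + n) (dIdx a b (i + 1)) := by
    intro x
    ext
    simp
  refine ⟨?_, ?_, ?_, ?_⟩
  · have := matrixDeriv_eq_zero hv
      (A := (genBlock (m + n) c (i + 1))ᵀ - genBlock (m + n) c (i + 1)) fun x hx => by
        rw [hsub, transpose_map, genBlock_map, (hZ x hx i hi).1.symm, sub_self]
    rwa [matrixDeriv_sub, matrixDeriv_genBlock_transpose, matrixDeriv_genBlock, sub_eq_zero] at this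
  · have := matrixDeriv_eq_zero hv (A := genBlock (m + n) c (i + 1) * genBlock (m + n) c (i + 1)
      - genBlock (m + n) c (i + 1)) fun x hx => by
        rw [hsub, Matrix.map_mul, genBlock_map, (hZ x hx i hi).1.idem, sub_self]
    rwa [matrixDeriv_sub, matrixDeriv_mul, matrixDeriv_genBlock, genBlock_map, sub_eq_zero] at this
  · have := matrixDeriv_eq_zero hv (A := genBlock (m + n) c (i + 1) *
      (D (m + n) (dIdx a b (i + 1))).map MvPolynomial.C
      - genBlock (m + n) c (i + 1)) fun x hx => by
        rw [hsub, Matrix.map_mul, genBlock_map, hD, (hZ x hx i hi).2.2.1, sub_self]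
    rwa [matrixDeriv_sub, matrixDeriv_mul, matrixDeriv_genBlock, hD, matrixDeriv_C,
      Matrix.mul_zero, add_zero, sub_eq_zero] at this
  · have := matrixDeriv_eq_zero hv (A := genBlock (m + n) c (i + 1) * genBlock (m + n) c i
      - genBlock (m + n) c i) fun x hx => by
        rw [hsub, Matrix.map_mul, genBlock_map, genBlock_map, (hZ x hx i hi).2.2.2, sub_self]
    rwa [matrixDeriv_sub, matrixDeriv_mul, matrixDeriv_genBlock, matrixDeriv_genBlock,
      genBlock_map, genBlock_map, sub_eq_zero] at this

/-- The dimension of the Bott–Samelson set. -/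
def bsDim (c : ℕ) (a b : ℕ → ℕ) : ℕ :=
  ∑ i : Fin c, (∑ l ∈ Finset.range (i + 1), b l) * a (i + 1)

/-- The submodule of the matrices `C` with `P C = C = C Q`. -/
def sandwich {ι : Type*} [Fintype ι] (P Q : Matrix ι ι ℝ) : Submodule ℝ (Matrix ι ι ℝ) where
  carrier := {C | P * C = C ∧ C * Q = C}
  zero_mem' := by simp
  add_mem' := by
    rintro A B ⟨h₁, h₂⟩ ⟨h₃, h₄⟩
    exact ⟨by rw [Matrix.mul_add, h₁, h₃], by rw [Matrix.add_mul, h₂, h₄]⟩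
  smul_mem' := by
    rintro r A ⟨h₁, h₂⟩
    exact ⟨by rw [Matrix.mul_smul, h₁], by rw [Matrix.smul_mul, h₂]⟩

theorem block_add {N : ℕ} (v w : Coord N c → ℝ) (i : ℕ) :
    block (v + w) i = block v i + block w i := by
  rw [block, block, block]
  split_ifs <;> ext <;> simp

theorem block_smul {N : ℕ} (r : ℝ) (v : Coord N c → ℝ) (i : ℕ) :
    block (r • v) i = r • block v i := by
  rw [block, block]
  split_ifs <;> ext <;> simp

/-- Infinitesimally, moving W_{i+1} with W_i fixed is a linear map from W_{i+1} ⊖ W_i to ℝ^{d_{i+1}}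
⊖ W_{i+1}. These spaces are the ranges of Q_i and P_i, of dimensions a_{i+1} and b_0 + … + b_i. -/
theorem finrank_tangentSpace_bottSamelson_le (h : IsStaircase n lam c a b)
    {x : Coord (m + n) c → ℝ} (hx : x ∈ bottSamelson m n c a b) :
    Module.finrank ℝ (tangentSpace (bottSamelson m n c a b) x) ≤ bsDim c a b := by
  have hZ := (mem_bottSamelson_iff h x).mp hx
  set T := tangentSpace (bottSamelson m n c a b) x
  let Y := block x
  let Dm : ℕ → Matrix (Fin (m + n)) (Fin (m + n)) ℝ := fun i => D (m + n) (dIdx a b i)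
  have hDP : ∀ i, (Dm i).IsOrthProj := fun i => D_isOrthProj _ _
  have hY : ∀ i ≤ c, (Y i).IsOrthProj ∧ (Y i).trace = mIdx a i := by
    intro i hi
    cases i with
    | zero => exact ⟨⟨by simp [Y, block_zero], by simp [Y, block_zero]⟩, by simp [Y, block_zero]⟩
    | succ i => exact ⟨(hZ i hi).1, (hZ i hi).2.1⟩
  have hDY : ∀ i < c, Dm (i + 1) * Y (i + 1) = Y (i + 1) := fun i hi =>
    ((hDP _).mul_eq_comm (hY _ hi).1).mpr (hZ i hi).2.2.1
  let P : ℕ → Matrix (Fin (m + n)) (Fin (m + n)) ℝ := fun i => Dm (i + 1) - Y (i + 1)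
  let Q : ℕ → Matrix (Fin (m + n)) (Fin (m + n)) ℝ := fun i => Y (i + 1) - Y i
  have hP : ∀ i < c, (P i).IsOrthProj := fun i hi => (hDP _).sub (hY _ hi).1 (hDY i hi)
  have hQ : ∀ i < c, (Q i).IsOrthProj := fun i hi =>
    (hY _ hi).1.sub (hY _ hi.le).1 (hZ i hi).2.2.2
  have hDH : ∀ v ∈ T, ∀ i < c, Dm (i + 1) * block v (i + 1) = block v (i + 1) := by
    intro v hv i hi
    obtain ⟨h1, -, h3, -⟩ := block_of_mem_tangentSpace h hv hi
    have := congrArg transpose h3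
    rwa [transpose_mul, h1, (hDP _).symm] at this
  let f : T →ₗ[ℝ] (i : Fin c) → sandwich (P i) (Q i) :=
    { toFun := fun v i => ⟨P i * block v.1 (i + 1) * Q i, by
        constructor
        · rw [← Matrix.mul_assoc, ← Matrix.mul_assoc, (hP i i.2).idem]
        · rw [Matrix.mul_assoc, (hQ i i.2).idem]⟩
      map_add' := fun v w => by
        ext1 i
        ext1
        simp [block_add, Matrix.mul_add, Matrix.add_mul]
      map_smul' := fun r v => by
        ext1 i
        ext1
        simp [block_smul] }
  have hf : Function.Injective f := by
    rw [injective_iff_map_eq_zero]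
    rintro ⟨v, hv⟩ hfv
    have hzero : ∀ i ≤ c, block v i = 0 := by
      intro i
      induction i with
      | zero => exact fun _ => block_zero v
      | succ i ih =>
        intro hi
        obtain ⟨h1, h2, h3, h4⟩ := block_of_mem_tangentSpace h hv hi
        have h5 : P i * block v (i + 1) * Q i = 0 := congrArg Subtype.val (congrFun hfv ⟨i, hi⟩)
        rw [ih (by omega), Matrix.mul_zero, add_zero] at h4
        -- Write V for the block i + 1 of v and Y for that of x. Once the previous block of v is
        -- zero, the linearized inclusion gives V Y_i = 0, so V Q_i = VY.
        have h6 : block v (i + 1) * Q i = block v (i + 1) * Y (i + 1) := by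
          rw [Matrix.mul_sub]
          change _ - block v (i + 1) * block x i = _
          rw [h4, sub_zero]
        rw [Matrix.mul_assoc, h6, Matrix.sub_mul, ← Matrix.mul_assoc, hDH v hv i hi] at h5
        -- Multiplying VY + YV = V by Y on the left gives YVY = 0. Hence P_i V Q_i = VY, and if this
        -- vanishes then so does V = VY + (VY)ᵀ.
        have h7 : Y (i + 1) * (block v (i + 1) * Y (i + 1)) = 0 := by
          have := congrArg (Y (i + 1) * ·) h2
          simp only [Matrix.mul_add] at this
          rw [← Matrix.mul_assoc (block x (i + 1)) (block x (i + 1)), (hZ i hi).1.idem] at this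
          simpa [Y] using this
        rw [h7, sub_zero] at h5
        have h8 := congrArg transpose h5
        rw [transpose_mul, h1, (hY _ hi).1.symm, transpose_zero] at h8
        rw [← h2]
        change _ * Y (i + 1) + Y (i + 1) * _ = _
        rw [h5, h8, add_zero]
    ext1
    have h9 := ofBlocks_block h.c_pos v
    have h10 := ofBlocks_block h.c_pos (0 : Coord (m + n) c → ℝ)
    change v = (0 : Coord (m + n) c → ℝ)
    rw [← h9, ← h10]
    refine ofBlocks_congr h.c_pos fun i hi => ?_
    rw [hzero _ hi]
    rw [block]
    split_ifs <;> rfl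
  refine (LinearMap.finrank_le_finrank_of_injective hf).trans ?_
  rw [Module.finrank_pi_fintype, bsDim]
  refine Finset.sum_le_sum fun i _ => ?_
  refine Matrix.finrank_sandwich_le (hP i i.2) (hQ i i.2) _ (fun C hC => hC) ?_ ?_
  · rw [trace_sub, trace_D (h.dIdx_le i.2), (hY _ i.2).2, dIdx_eq]
    push_cast
    ring
  · rw [trace_sub, (hY _ i.2).2, (hY _ i.2.le).2, mIdx_succ]
    push_cast
    ring

end Schubert

end

/-! ### Adapted frames and irreducibility of Z. -/

section

open Matrix

namespace Schubert

open RealAlg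

section Frames

/-- The index set of the columns of a basis adapted to a flag with steps `a 1, …, a c`. -/
abbrev ColIdx (c : ℕ) (a : ℕ → ℕ) := Σ i : Fin c, Fin (a (i + 1))

variable {m n c : ℕ} {lam : Fin m → ℕ} {a b : ℕ → ℕ}

theorem card_colIdx_lt {i : ℕ} (hi : i ≤ c) :
    Fintype.card {j : ColIdx c a // (j.1 : ℕ) < i} = mIdx a i := by
  rw [Fintype.card_subtype]
  have h1 : (Finset.univ.filter fun j : ColIdx c a => (j.1 : ℕ) < i) =
      (Finset.univ.filter fun k : Fin c => (k : ℕ) < i).sigma fun _ => Finset.univ := by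
    ext j
    simp
  rw [h1, Finset.card_sigma]
  simp only [Finset.card_univ, Fintype.card_fin]
  rw [Finset.sum_filter, Fin.sum_univ_eq_sum_range (fun k => if k < i then a (k + 1) else 0) c,
    ← Finset.sum_filter]
  have h2 : (Finset.range c).filter (· < i) = Finset.range i := by
    ext k
    simp only [Finset.mem_filter, Finset.mem_range]
    omega
  rw [h2]
  clear h1 h2 hi
  induction i with
  | zero => simp
  | succ i ih => rw [Finset.sum_range_succ, ih, mIdx_succ]

theorem sum_colIdx_lt (i : ℕ) (f : ColIdx c a → ℝ) :
    ∑ j : {j : ColIdx c a // (j.1 : ℕ) < i}, f j.1 =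
      ∑ k ∈ Finset.univ.filter fun k : Fin c => (k : ℕ) < i, ∑ r, f ⟨k, r⟩ := by
  rw [← Finset.sum_subtype (Finset.univ.filter fun j : ColIdx c a => (j.1 : ℕ) < i) (by simp) f,
    Finset.sum_sigma']
  refine Finset.sum_congr ?_ fun _ _ => rfl
  ext j
  simp

theorem sum_colIdx_lt_succ {i : ℕ} (hi : i < c) (f : ColIdx c a → ℝ) :
    ∑ j : {j : ColIdx c a // (j.1 : ℕ) < i + 1}, f j.1 =
      ∑ j : {j : ColIdx c a // (j.1 : ℕ) < i}, f j.1 + ∑ r, f ⟨⟨i, hi⟩, r⟩ := by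
  rw [sum_colIdx_lt, sum_colIdx_lt]
  have h1 : (Finset.univ.filter fun k : Fin c => (k : ℕ) < i + 1) =
      insert ⟨i, hi⟩ (Finset.univ.filter fun k : Fin c => (k : ℕ) < i) := by
    ext k
    simp only [Finset.mem_filter, Finset.mem_univ, true_and, Finset.mem_insert, Fin.ext_iff]
    omega
  rw [h1, Finset.sum_insert (by simp), add_comm]

/-- The columns of level less than `i`. -/
def lowCols {N : ℕ} {R : Type*} (B : Matrix (Fin N) (ColIdx c a) R) (i : ℕ) :
    Matrix (Fin N) {j : ColIdx c a // (j.1 : ℕ) < i} R := B.submatrix id Subtype.val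

/-- The column `j` of `B` lies in the member of the flag prescribed by its level. -/
def IsAdapted (b : ℕ → ℕ) {N : ℕ} (B : Matrix (Fin N) (ColIdx c a) ℝ) : Prop :=
  ∀ (p : Fin N) (j : ColIdx c a), dIdx a b (j.1 + 1) ≤ (p : ℕ) → B p j = 0

/-- The first columns span nested subspaces, and a column of level below i + 1 lies in ℝ^{d_{i+1}}
because d is monotone. -/
theorem ofBlocks_spanProj_mem (h : IsStaircase n lam c a b)
    {B : Matrix (Fin (m + n)) (ColIdx c a) ℝ} (hB : IsAdapted b B)
    (hdet : ∀ i < c, (lowCols B (i + 1)).gramDet ≠ 0) :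
    ofBlocks c (fun i => (lowCols B i).spanProj) ∈ bottSamelson m n c a b := by
  rw [mem_bottSamelson_iff h]
  intro i hi
  rw [block_ofBlocks h.c_pos _ hi]
  have hP := spanProj_isOrthProj (hdet i hi)
  refine ⟨hP, by rw [trace_spanProj (hdet i hi), card_colIdx_lt hi], ?_, ?_⟩
  · rw [← (D_isOrthProj _ _).mul_eq_comm hP]
    apply mul_spanProj
    ext p j
    rw [D, diagonal_mul]
    split_ifs with hp
    · rw [one_mul]
    · rw [zero_mul]
      exact (hB p j.1 ((dIdx_mono a b (by have := j.2; omega)).trans (not_lt.mp hp))).symm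
  · cases i with
    | zero => rw [block_zero, Matrix.mul_zero]
    | succ i =>
      rw [block_ofBlocks h.c_pos _ (by omega)]
      apply mul_spanProj
      have h1 := spanProj_mul (hdet (i + 1) hi)
      ext p j
      exact congrFun (congrFun h1 p) ⟨j.1, by have := j.2; omega⟩

/-- Concatenate orthonormal bases of the ranges of Y_{i+1} - Y_i. These ranges are mutually
orthogonal and the sums of the projections telescope. -/
theorem exists_frame (h : IsStaircase n lam c a b) {x : Coord (m + n) c → ℝ}
    (hx : x ∈ bottSamelson m n c a b) : ∃ B : Matrix (Fin (m + n)) (ColIdx c a) ℝ,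
      IsAdapted b B ∧ Bᵀ * B = 1 ∧
      ∀ i < c, lowCols B (i + 1) * (lowCols B (i + 1))ᵀ = block x (i + 1) := by
  have hZ := (mem_bottSamelson_iff h x).mp hx
  let Y := block x
  have hY : ∀ i ≤ c, (Y i).IsOrthProj ∧ (Y i).trace = mIdx a i := by
    intro i hi
    cases i with
    | zero => exact ⟨⟨by simp [Y, block_zero], by simp [Y, block_zero]⟩, by simp [Y, block_zero]⟩
    | succ i => exact ⟨(hZ i hi).1, (hZ i hi).2.1⟩
  have hQ : ∀ i < c, (Y (i + 1) - Y i).IsOrthProj := fun i hi =>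
    (hY _ hi).1.sub (hY _ hi.le).1 (hZ i hi).2.2.2
  have hQtr : ∀ i < c, (Y (i + 1) - Y i).trace = a (i + 1) := fun i hi => by
    rw [trace_sub, (hY _ hi).2, (hY _ hi.le).2, mIdx_succ]
    push_cast
    ring
  have hYmul : ∀ i j, i ≤ j → j ≤ c → Y j * Y i = Y i := by
    intro i j hij
    induction j, hij using Nat.le_induction with
    | base => exact fun hi => (hY i hi).1.idem
    | succ j hij ih =>
      intro hj
      rw [← ih (by omega), ← Matrix.mul_assoc]
      congr 1
      exact (hZ j hj).2.2.2
  have hQQ : ∀ i j, i < j → j < c → (Y (j + 1) - Y j) * (Y (i + 1) - Y i) = 0 := by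
    intro i j hij hj
    rw [Matrix.sub_mul, Matrix.mul_sub, Matrix.mul_sub, hYmul _ _ (by omega) (by omega),
      hYmul _ _ (by omega) (by omega), hYmul _ _ (by omega) (by omega),
      hYmul _ _ (by omega) (by omega), sub_self]
  choose C hC hC' using fun i : Fin c => (hQ i i.2).exists_orthonormal (hQtr i i.2)
  have hQC : ∀ i : Fin c, (Y (i + 1) - Y i) * C i = C i := fun i => by
    rw [← hC', Matrix.mul_assoc, hC, Matrix.mul_one]
  have hCC : ∀ i j : Fin c, i < j → (C j)ᵀ * C i = 0 := by
    intro i j hij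
    rw [← hQC i, ← hQC j, transpose_mul, (hQ j j.2).symm, Matrix.mul_assoc,
      ← Matrix.mul_assoc _ _ (C i), hQQ i j hij j.2, Matrix.zero_mul, Matrix.mul_zero]
  let B : Matrix (Fin (m + n)) (ColIdx c a) ℝ := Matrix.of fun p j => C j.1 p j.2
  refine ⟨B, ?_, ?_, ?_⟩
  · intro p j hp
    have h1 : Y (j.1 + 1) * C j.1 = C j.1 := by
      rw [← hQC j.1, ← Matrix.mul_assoc, Matrix.mul_sub, (hY _ j.1.2).1.idem, (hZ j.1 j.1.2).2.2.2]
    have h2 : D (m + n) (dIdx a b (j.1 + 1)) * C j.1 = C j.1 := by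
      rw [← h1, ← Matrix.mul_assoc]
      congr 1
      exact ((D_isOrthProj _ _).mul_eq_comm (hY _ j.1.2).1).mpr (hZ j.1 j.1.2).2.2.1
    change C j.1 p j.2 = 0
    rw [← h2, D, diagonal_mul, if_neg (by omega), zero_mul]
  · ext ⟨i, r⟩ ⟨j, s⟩
    have h1 : (Bᵀ * B) ⟨i, r⟩ ⟨j, s⟩ = ((C i)ᵀ * C j) r s := rfl
    rw [h1]
    rcases lt_trichotomy i j with hij | rfl | hij
    · have := congrArg transpose (hCC i j hij)
      rw [transpose_mul, transpose_transpose, transpose_zero] at this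
      rw [this, one_apply_ne]
      · rfl
      · rintro ⟨⟩
        exact lt_irrefl _ hij
    · rw [hC, one_apply, one_apply]
      simp
    · rw [hCC j i hij, one_apply_ne]
      · rfl
      · rintro ⟨⟩
        exact lt_irrefl _ hij
  · have hsum : ∀ i ≤ c, lowCols B i * (lowCols B i)ᵀ = Y i := by
      intro i
      induction i with
      | zero =>
        intro _
        simp only [Y, block_zero]
        ext p q
        rw [mul_apply]
        exact Finset.sum_eq_zero fun j _ => absurd j.2 (by omega)
      | succ i ih =>
        intro hi
        rw [← add_sub_cancel (Y i) (Y (i + 1))]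
        have := hC' ⟨i, hi⟩
        simp only at this
        rw [← this, ← ih (by omega)]
        ext p q
        exact sum_colIdx_lt_succ hi fun j => B p j * B q j
    exact fun i hi => hsum (i + 1) hi

theorem lowCols_orthonormal {N : ℕ} {B : Matrix (Fin N) (ColIdx c a) ℝ} (hB : Bᵀ * B = 1) (i : ℕ) :
    (lowCols B i)ᵀ * lowCols B i = 1 := by
  have h1 : (lowCols B i)ᵀ * lowCols B i =
    (Bᵀ * B).submatrix Subtype.val Subtype.val := rfl
  rw [h1, hB, submatrix_one _ Subtype.val_injective]

/-- Orthonormality is relaxed to nonzero Gram determinants, so that the parameters range over a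
Zariski open subset of an affine space. -/
theorem mem_bottSamelson_iff_exists_frame (h : IsStaircase n lam c a b)
    (x : Coord (m + n) c → ℝ) :
    x ∈ bottSamelson m n c a b ↔ ∃ B : Matrix (Fin (m + n)) (ColIdx c a) ℝ, IsAdapted b B ∧
      (∀ i < c, (lowCols B (i + 1)).gramDet ≠ 0) ∧
      ofBlocks c (fun i => (lowCols B i).spanProj) = x := by
  constructor
  · intro hx
    obtain ⟨B, hB, hB1, hB2⟩ := exists_frame h hx
    refine ⟨B, hB, fun i hi => ?_, ?_⟩
    · rw [gramDet_of_orthonormal (lowCols_orthonormal hB1 _)]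
      exact one_ne_zero
    · rw [← ofBlocks_block h.c_pos x]
      refine ofBlocks_congr h.c_pos fun i hi => ?_
      rw [spanProj_of_orthonormal (lowCols_orthonormal hB1 _), hB2 i hi]
  · rintro ⟨B, hB, hdet, rfl⟩
    exact ofBlocks_spanProj_mem h hB hdet

end Frames

section Param

variable {σ : Type*} {N c : ℕ} {a b : ℕ → ℕ}

/-- The common denominator of the parametrization of a Bott–Samelson set by frames. -/
noncomputable def frameDenom (B : Matrix (Fin N) (ColIdx c a) (MvPolynomial σ ℝ)) :
    MvPolynomial σ ℝ := ∏ i ∈ Finset.range c, (lowCols B (i + 1)).gramDet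

/-- The numerators of the parametrization of a Bott–Samelson set by frames. -/
noncomputable def frameNum (B : Matrix (Fin N) (ColIdx c a) (MvPolynomial σ ℝ)) :
    Coord N c → MvPolynomial σ ℝ :=
  -- Block i has denominator the Gram determinant of factor i - 1; the remaining factors bring it to
  -- the common denominator.
  ofBlocks c fun i => (∏ l ∈ (Finset.range c).erase (i - 1), (lowCols B (l + 1)).gramDet) •
    (lowCols B i).gramAdj

theorem lowCols_map {R S : Type*} (B : Matrix (Fin N) (ColIdx c a) R) (f : R → S) (i : ℕ) :
    (lowCols B i).map f = lowCols (B.map f) i := rfl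

theorem eval_frameDenom (B : Matrix (Fin N) (ColIdx c a) (MvPolynomial σ ℝ)) (t : σ → ℝ) :
    MvPolynomial.eval t (frameDenom B) =
      ∏ i ∈ Finset.range c, (lowCols (B.map (MvPolynomial.eval t)) (i + 1)).gramDet := by
  rw [frameDenom, map_prod]
  simp only [gramDet_map, lowCols_map]

theorem eval_frameDenom_ne_zero (B : Matrix (Fin N) (ColIdx c a) (MvPolynomial σ ℝ)) (t : σ → ℝ) :
    MvPolynomial.eval t (frameDenom B) ≠ 0 ↔
      ∀ i < c, (lowCols (B.map (MvPolynomial.eval t)) (i + 1)).gramDet ≠ 0 := by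
  rw [eval_frameDenom, Finset.prod_ne_zero_iff]
  simp

theorem paramPoint_frame (hc : 1 ≤ c) (B : Matrix (Fin N) (ColIdx c a) (MvPolynomial σ ℝ))
    {t : σ → ℝ} (ht : MvPolynomial.eval t (frameDenom B) ≠ 0) :
    paramPoint (frameDenom B) (frameNum B) t =
      ofBlocks c fun i => (lowCols (B.map (MvPolynomial.eval t)) i).spanProj := by
  have h1 := (eval_frameDenom_ne_zero B t).mp ht
  have key : ∀ (i : ℕ) (hi : i < c) (p q : Fin N),
      MvPolynomial.eval t (((∏ l ∈ (Finset.range c).erase (i + 1 - 1),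
        (lowCols B (l + 1)).gramDet) • (lowCols B (i + 1)).gramAdj) p q) /
        MvPolynomial.eval t (frameDenom B) =
      (lowCols (B.map (MvPolynomial.eval t)) (i + 1)).spanProj p q := by
    intro i hi p q
    have h2 := congrFun (congrFun (gramAdj_map (lowCols B (i + 1)) (MvPolynomial.eval t)) p) q
    rw [map_apply, lowCols_map] at h2
    rw [spanProj, Matrix.smul_apply, Matrix.smul_apply, smul_eq_mul, smul_eq_mul, map_mul, h2, frameDenom,
      ← Finset.mul_prod_erase _ _ (Finset.mem_range.mpr hi), map_mul, gramDet_map, lowCols_map,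
      Nat.add_sub_cancel]
    have h3 : MvPolynomial.eval t
        (∏ l ∈ (Finset.range c).erase i, (lowCols B (l + 1)).gramDet) ≠ 0 := by
      rw [map_prod, Finset.prod_ne_zero_iff]
      intro l hl
      rw [gramDet_map, lowCols_map]
      exact h1 l (Finset.mem_range.mp (Finset.mem_of_mem_erase hl))
    have h4 := h1 i hi
    field_simp
  ext (s | ⟨i, s⟩)
  · have := key (c - 1) (by omega) s.1 s.2
    rw [Nat.sub_add_cancel hc] at this
    exact this
  · exact key i (by omega) s.1 s.2

/-- The generic adapted frame. -/
noncomputable def genFrame (N c : ℕ) (a b : ℕ → ℕ) :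
    Matrix (Fin N) (ColIdx c a) (MvPolynomial (Fin N × ColIdx c a) ℝ) :=
  Matrix.of fun p j => if (p : ℕ) < dIdx a b (j.1 + 1) then MvPolynomial.X (p, j) else 0

theorem exists_genFrame_map_iff (B : Matrix (Fin N) (ColIdx c a) ℝ) :
    (∃ t, (genFrame N c a b).map (MvPolynomial.eval t) = B) ↔ IsAdapted b B := by
  constructor
  · rintro ⟨t, rfl⟩ p j hp
    simp [genFrame, not_lt.mpr hp]
  · intro hB
    refine ⟨fun s => B s.1 s.2, ?_⟩
    ext p j
    by_cases hp : (p : ℕ) < dIdx a b (j.1 + 1)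
    · simp [genFrame, hp]
    · simp [genFrame, hp, hB p j (not_lt.mp hp)]

end Param

variable {m n c : ℕ} {lam : Fin m → ℕ} {a b : ℕ → ℕ}

theorem isPrime_vanishingIdeal_bottSamelson (h : IsStaircase n lam c a b)
    (hne : (bottSamelson m n c a b).Nonempty) :
    (MvPolynomial.vanishingIdeal ℝ (bottSamelson m n c a b)).IsPrime := by
  let B := genFrame (m + n) c a b
  have hV : ∀ x, x ∈ bottSamelson m n c a b ↔ ∃ t, MvPolynomial.eval t (frameDenom B) ≠ 0 ∧
      paramPoint (frameDenom B) (frameNum B) t = x := by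
    intro x
    rw [mem_bottSamelson_iff_exists_frame h]
    constructor
    · rintro ⟨A, hA, hdet, rfl⟩
      obtain ⟨t, rfl⟩ := (exists_genFrame_map_iff A).mpr hA
      have ht := (eval_frameDenom_ne_zero B t).mpr hdet
      exact ⟨t, ht, paramPoint_frame h.c_pos B ht⟩
    · rintro ⟨t, ht, rfl⟩
      exact ⟨B.map (MvPolynomial.eval t), (exists_genFrame_map_iff _).mp ⟨t, rfl⟩,
        (eval_frameDenom_ne_zero B t).mp ht, (paramPoint_frame h.c_pos B ht).symm⟩
  refine isPrime_vanishingIdeal_of_param ?_ _ hV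
  obtain ⟨x, hx⟩ := hne
  obtain ⟨t, ht, -⟩ := (hV x).mp hx
  intro h0
  rw [h0, map_zero] at ht
  exact ht rfl

end Schubert

end

/-! ### Schubert conditions, rational equations of σ, and σ as the projection of Z. -/

section

open Matrix

namespace Matrix

variable {n : Type*} [Fintype n] [DecidableEq n]

theorem interMatrix_map {R S : Type*} [CommRing R] [CommRing S] (X D : Matrix n n R)
    (f : R →+* S) : (interMatrix X D).map f = interMatrix (X.map f) (D.map f) := by
  have h : ∀ A : Matrix n n R, A.map f = f.mapMatrix A := fun _ => rfl
  simp only [h, interMatrix, map_add, map_mul, map_sub, map_one]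

end Matrix

namespace Schubert

open RealAlg

variable {m n c : ℕ} {lam : Fin m → ℕ} {a b : ℕ → ℕ}

/-- The intersection of the range of `X` with a member of the canonical flag. -/
noncomputable def flagInter {N : ℕ} (X : Matrix (Fin N) (Fin N) ℝ) (d : ℕ) :
    Submodule ℝ (Fin N → ℝ) :=
  LinearMap.range (toLin' X) ⊓ LinearMap.range (toLin' (D N d))

theorem finrank_range_D {N d : ℕ} (h : d ≤ N) :
    Module.finrank ℝ (LinearMap.range (toLin' (D N d))) = d :=
  (D_isOrthProj N d).trace_eq_iff.mp (trace_D h)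

theorem range_D_mono (N : ℕ) {d e : ℕ} (h : d ≤ e) :
    LinearMap.range (toLin' (D N d)) ≤ LinearMap.range (toLin' (D N e)) := by
  intro v hv
  rw [(D_isOrthProj N _).mem_range_iff, D_mulVec_eq_iff] at hv ⊢
  exact fun i hi => hv i (h.trans hi)

/-- Dimension formula inside ℝ^e. It deduces the Schubert conditions between two corners of the
partition from those at the corners. -/
theorem finrank_flagInter_le {N d e : ℕ} (X : Matrix (Fin N) (Fin N) ℝ) (h : d ≤ e) (he : e ≤ N) :
    Module.finrank ℝ (flagInter X e) ≤ Module.finrank ℝ (flagInter X d) + (e - d) := by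
  have h1 : flagInter X d = flagInter X e ⊓ LinearMap.range (toLin' (D N d)) := by
    rw [flagInter, flagInter, inf_assoc, inf_eq_right.mpr (range_D_mono N h)]
  have h2 := Submodule.finrank_sup_add_finrank_inf_eq (flagInter X e)
    (LinearMap.range (toLin' (D N d)))
  have h3 : Module.finrank ℝ ↥(flagInter X e ⊔ LinearMap.range (toLin' (D N d))) ≤ e := by
    conv_rhs => rw [← finrank_range_D he]
    exact Submodule.finrank_mono (sup_le inf_le_right (range_D_mono N h))
  rw [← h1, finrank_range_D (h.trans he)] at h2
  omega

theorem sum_b_eq (h : IsStaircase n lam c a b) {i : ℕ} (hi : i ≤ c) :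
    ∑ k ∈ Finset.range i, b k + ∑ k ∈ Finset.Ico i c, b k = n := by
  rw [Finset.sum_range_add_sum_Ico _ hi, h.sum_b]

/-- If the k-th part belongs to the i-th group, then n + k - λ_k = d_i - (m_i - k), so the condition
for k follows from the one for k = m_i. -/
theorem mem_schubertVariety_iff (h : IsStaircase n lam c a b)
    (x : Fin (m + n) × Fin (m + n) → ℝ) :
    x ∈ schubertVariety n lam ↔ (toMatrix x).IsOrthProj ∧ (toMatrix x).trace = m ∧
      ∀ i ≤ c, mIdx a i ≤ Module.finrank ℝ (flagInter (toMatrix x) (dIdx a b i)) := by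
  rw [schubertVariety, Set.mem_ofPred_eq]
  constructor
  · rintro ⟨⟨h1, h2, h3⟩, h4⟩
    have h4' : ∀ (k : ℕ) (hk : k < m), k + 1 ≤ Module.finrank ℝ
        (flagInter (toMatrix x) (n + (k + 1) - lam ⟨k, hk⟩)) := fun k hk => by
      rw [flagInter, ← flag_eq]
      exact h4 ⟨k, hk⟩
    clear h4
    refine ⟨⟨h1, h2⟩, h3, fun i hi => ?_⟩
    rcases Nat.eq_zero_or_pos i with rfl | hi0
    · simp
    rcases hi.lt_or_eq with hic | rfl
    -- Positivity of a_i ensures that the part numbered m_i exists and lies in group i; its flag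
    -- index is then exactly d_i.
    · have ha := h.a_pos i hi0 hic
      have hm : mIdx a i ≤ m := h.mIdx_eq ▸ mIdx_mono a hi
      obtain ⟨i, rfl⟩ := Nat.exists_eq_succ_of_ne_zero hi0.ne'
      have hs := mIdx_succ a i
      simp only [Nat.succ_eq_add_one] at *
      have hj : mIdx a (i + 1) - 1 < m := by omega
      have h5 := h4' (mIdx a (i + 1) - 1) hj
      have h6 := h.parts ⟨mIdx a (i + 1) - 1, hj⟩ (i + 1) hi0 hi (by simp; omega) (by simp; omega)
      have h7 := sum_b_eq h hi
      have h8 := dIdx_eq a b (i + 1)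
      have h9 : n + (mIdx a (i + 1) - 1 + 1) - lam ⟨mIdx a (i + 1) - 1, hj⟩ =
          dIdx a b (i + 1) := by
        rw [h6]
        omega
      rw [h9] at h5
      omega
    -- At i = c the flag member is the whole space and the condition is the rank of X.
    · rw [flagInter, D_eq_one h.dIdx_eq.ge, toLin'_one, LinearMap.range_id, inf_top_eq, h.mIdx_eq]
      exact ((IsOrthProj.trace_eq_iff ⟨h1, h2⟩).mp h3).ge
  · rintro ⟨h1, h2, h3⟩
    refine ⟨⟨h1.symm, h1.idem, h2⟩, fun j => ?_⟩
    have hex : ∃ i, (j : ℕ) + 1 ≤ mIdx a i := ⟨c, by rw [h.mIdx_eq]; exact j.2⟩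
    classical
    -- The group containing the part numbered j + 1.
    let i := Nat.find hex
    have hi1 : (j : ℕ) + 1 ≤ mIdx a i := Nat.find_spec hex
    have hic : i ≤ c := Nat.find_min' hex (by rw [h.mIdx_eq]; exact j.2)
    have hi0 : 1 ≤ i := by
      by_contra h0
      have : i = 0 := by omega
      rw [this, mIdx_zero] at hi1
      omega
    have hi2 : mIdx a (i - 1) < (j : ℕ) + 1 :=
      not_le.mp (Nat.find_min hex (show i - 1 < i by omega))
    have h6 := h.parts j i hi0 hic hi2 hi1
    have h7 := sum_b_eq h hic
    have h8 := dIdx_eq a b i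
    rw [flag_eq]
    change _ ≤ Module.finrank ℝ (flagInter (toMatrix x) _)
    have h9 := finrank_flagInter_le (toMatrix x)
      (show n + ((j : ℕ) + 1) - lam j ≤ dIdx a b i by omega) (h.dIdx_le hic)
    have h10 := h3 i hic
    omega

/-- The generic square matrix. -/
noncomputable def genMatrix (K : Type*) [CommRing K] (N : ℕ) :
    Matrix (Fin N) (Fin N) (MvPolynomial (Fin N × Fin N) K) :=
  Matrix.of fun p r => MvPolynomial.X (p, r)

/-- The generic matrix whose kernel is the intersection with a member of the canonical flag. -/
noncomputable def genInter (K : Type*) [CommRing K] (N d : ℕ) :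
    Matrix (Fin N) (Fin N) (MvPolynomial (Fin N × Fin N) K) :=
  interMatrix (genMatrix K N) (diagonal fun i => if (i : ℕ) < d then 1 else 0)

theorem genMatrix_map {K : Type*} [CommRing K] [Algebra K ℝ] {N : ℕ} (x : Fin N × Fin N → ℝ) :
    (genMatrix K N).map (MvPolynomial.aeval x) = toMatrix x := by
  ext
  simp [genMatrix, toMatrix]

theorem genInter_map {K : Type*} [CommRing K] [Algebra K ℝ] {N : ℕ} (d : ℕ)
    (x : Fin N × Fin N → ℝ) :
    (genInter K N d).map (MvPolynomial.aeval (R := K) x) = interMatrix (toMatrix x) (D N d) := by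
  have h := interMatrix_map (genMatrix K N) (diagonal fun i => if (i : ℕ) < d then 1 else 0)
    (MvPolynomial.aeval (R := K) x).toRingHom
  refine h.trans ?_
  congr 1
  · exact genMatrix_map x
  · rw [D, diagonal_map (map_zero _)]
    congr 1
    ext i
    split_ifs <;> simp

theorem aeval_coeff_charpoly_genInter {K : Type*} [CommRing K] [Algebra K ℝ] {N : ℕ} (d k : ℕ)
    (x : Fin N × Fin N → ℝ) :
    MvPolynomial.aeval x ((genInter K N d).charpoly.coeff k) =
      (interMatrix (toMatrix x) (D N d)).charpoly.coeff k := by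
  rw [← genInter_map (K := K)]
  have := charpoly_map (genInter K N d) (MvPolynomial.aeval (R := K) x).toRingHom
  refine Eq.trans ?_ (congrArg (fun p => p.coeff k) this.symm)
  simp

theorem ker_interMatrix_eq {N : ℕ} {X : Matrix (Fin N) (Fin N) ℝ} (hX : X.IsOrthProj) (d : ℕ) :
    LinearMap.ker (toLin' (interMatrix X (D N d))) = flagInter X d :=
  hX.ker_interMatrix (D_isOrthProj N d)

theorem le_finrank_flagInter_iff {N : ℕ} {X : Matrix (Fin N) (Fin N) ℝ} (hX : X.IsOrthProj)
    (d k : ℕ) : k ≤ Module.finrank ℝ (flagInter X d) ↔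
      ∀ l < k, (interMatrix X (D N d)).charpoly.coeff l = 0 := by
  rw [← ker_interMatrix_eq hX, le_finrank_ker_iff (hX.interMatrix_symm (D_isOrthProj N d))]

theorem mem_schubertVariety_iff_coeff (x : Fin (m + n) × Fin (m + n) → ℝ) :
    x ∈ schubertVariety n lam ↔ ((toMatrix x)ᵀ = toMatrix x ∧ toMatrix x * toMatrix x = toMatrix x) ∧
      (toMatrix x).trace = m ∧ ∀ j : Fin m, ∀ l < (j : ℕ) + 1, (interMatrix (toMatrix x)
        (D (m + n) (n + ((j : ℕ) + 1) - lam j))).charpoly.coeff l = 0 := by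
  rw [schubertVariety, Set.mem_ofPred_eq]
  constructor
  · rintro ⟨⟨h1, h2, h3⟩, h4⟩
    refine ⟨⟨h1, h2⟩, h3, fun j => ?_⟩
    rw [← le_finrank_flagInter_iff ⟨h1, h2⟩, flagInter, ← flag_eq]
    exact h4 j
  · rintro ⟨⟨h1, h2⟩, h3, h4⟩
    refine ⟨⟨h1, h2, h3⟩, fun j => ?_⟩
    have h5 := h4 j
    rw [← le_finrank_flagInter_iff ⟨h1, h2⟩, flagInter, ← flag_eq] at h5
    exact h5

/-- The matrices D have entries 0 and 1, so the characteristic polynomial of the generic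
intersection matrix already has coefficients in ℚ[x]. -/
theorem isAlgebraicSet_schubertVariety : IsAlgebraicSet ℚ (schubertVariety n lam) := by
  let G := genMatrix ℚ (m + n)
  have hsub : ∀ (x : Fin (m + n) × Fin (m + n) → ℝ) (A B : Matrix (Fin (m + n)) (Fin (m + n))
      (MvPolynomial (Fin (m + n) × Fin (m + n)) ℚ)), (A - B).map (MvPolynomial.aeval x) =
      A.map (MvPolynomial.aeval x) - B.map (MvPolynomial.aeval x) :=
    fun x A B => Matrix.map_sub _ (map_sub _) _ _
  have hG : ∀ x, G.map (MvPolynomial.aeval x) = toMatrix x := genMatrix_map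
  have h1 : ∀ x, (toMatrix x)ᵀ = toMatrix x ↔ (Gᵀ - G).map (MvPolynomial.aeval x) = 0 :=
    fun x => by rw [hsub, transpose_map, hG, sub_eq_zero]
  have h2 : ∀ x, toMatrix x * toMatrix x = toMatrix x ↔
      (G * G - G).map (MvPolynomial.aeval x) = 0 :=
    fun x => by rw [hsub, Matrix.map_mul, hG, sub_eq_zero]
  have h3 : ∀ x, (toMatrix x).trace = m ↔
      ∀ _ : Unit, MvPolynomial.aeval x (G.trace - (m : MvPolynomial _ ℚ)) = 0 := fun x => by
    rw [forall_const, map_sub, map_natCast, AddMonoidHom.map_trace, ← hG, sub_eq_zero]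
  let p : {s : Fin m × ℕ // s.2 < s.1 + 1} → MvPolynomial (Fin (m + n) × Fin (m + n)) ℚ :=
    fun s => (genInter ℚ (m + n) (n + ((s.1.1 : ℕ) + 1) - lam s.1.1)).charpoly.coeff s.1.2
  have h4 : ∀ x, (∀ j : Fin m, ∀ l < (j : ℕ) + 1, (interMatrix (toMatrix x)
      (D (m + n) (n + ((j : ℕ) + 1) - lam j))).charpoly.coeff l = 0) ↔
      ∀ s, MvPolynomial.aeval x (p s) = 0 := fun x => by
    simp only [p, aeval_coeff_charpoly_genInter]
    exact ⟨fun H s => H s.1.1 s.1.2 s.2, fun H j l hl => H ⟨(j, l), hl⟩⟩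
  have : schubertVariety n lam =
      ({x | (Gᵀ - G).map (MvPolynomial.aeval x) = 0} ∩
        {x | (G * G - G).map (MvPolynomial.aeval x) = 0}) ∩
      ({x | ∀ _ : Unit, MvPolynomial.aeval x (G.trace - (m : MvPolynomial _ ℚ)) = 0} ∩
        {x | ∀ s, MvPolynomial.aeval x (p s) = 0}) := by
    ext x
    rw [mem_schubertVariety_iff_coeff, h1, h2, h3, h4]
    rfl
  rw [this]
  exact .inter (.inter (isAlgebraicSet_setOf_map_eq_zero _) (isAlgebraicSet_setOf_map_eq_zero _))
    (.inter (isAlgebraicSet_setOf_aeval_eq_zero _) (isAlgebraicSet_setOf_aeval_eq_zero _))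

theorem block_mul_block (h : IsStaircase n lam c a b) {y : Coord (m + n) c → ℝ}
    (hy : y ∈ bottSamelson m n c a b) {i j : ℕ} (hij : i ≤ j) (hj : j ≤ c) :
    block y j * block y i = block y i := by
  have hZ := (mem_bottSamelson_iff h y).mp hy
  induction j, hij using Nat.le_induction with
  | base =>
    cases i with
    | zero => simp [block_zero]
    | succ i => exact (hZ i hj).1.idem
  | succ j hij ih =>
    rw [← ih (by omega), ← Matrix.mul_assoc]
    congr 1
    exact (hZ j hj).2.2.2

theorem block_isOrthProj (h : IsStaircase n lam c a b) {y : Coord (m + n) c → ℝ}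
    (hy : y ∈ bottSamelson m n c a b) {i : ℕ} (hi : i ≤ c) :
    (block y i).IsOrthProj ∧ (block y i).trace = mIdx a i := by
  cases i with
  | zero => exact ⟨⟨by simp [block_zero], by simp [block_zero]⟩, by simp [block_zero]⟩
  | succ i =>
    have hZ := (mem_bottSamelson_iff h y).mp hy i hi
    exact ⟨hZ.1, hZ.2.1⟩

theorem range_block_le (h : IsStaircase n lam c a b) {y : Coord (m + n) c → ℝ}
    (hy : y ∈ bottSamelson m n c a b) {i : ℕ} (hi : i ≤ c) :
    LinearMap.range (toLin' (block y i)) ≤ flagInter (block y c) (dIdx a b i) := by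
  refine le_inf ?_ ?_
  · rw [← (block_isOrthProj h hy le_rfl).1.mul_eq_iff (block_isOrthProj h hy hi).1]
    exact block_mul_block h hy hi le_rfl
  · rw [← (D_isOrthProj _ _).mul_eq_iff (block_isOrthProj h hy hi).1]
    cases i with
    | zero => rw [block_zero, Matrix.mul_zero]
    | succ i =>
      have hZ := (mem_bottSamelson_iff h y).mp hy i hi
      exact ((D_isOrthProj _ _).mul_eq_comm hZ.1).mpr hZ.2.2.1

theorem toMatrix_inl (h : IsStaircase n lam c a b) (y : Coord (m + n) c → ℝ) :
    toMatrix (fun s => y (Sum.inl s)) = block y c := (block_last h.c_pos y).symm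

/-- Greedy choice: W_c ⊆ F_c ⊆ F_{c+1} and the dimensions leave room for a W_{c+1} between W_c and
F_{c+1}. -/
theorem exists_nested {V : Type*} [AddCommGroup V] [Module ℝ V] [FiniteDimensional ℝ V]
    {d : ℕ → ℕ} (hd0 : d 0 = 0) (hd : Monotone d) {F : ℕ → Submodule ℝ V} (hF : Monotone F) {c : ℕ}
    (h : ∀ i ≤ c, d i ≤ Module.finrank ℝ (F i)) :
    ∃ W : ℕ → Submodule ℝ V, (∀ i ≤ c, W i ≤ F i ∧ Module.finrank ℝ (W i) = d i) ∧
      ∀ i < c, W i ≤ W (i + 1) := by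
  induction c with
  | zero =>
    refine ⟨fun _ => ⊥, ?_, fun i hi => absurd hi (Nat.not_lt_zero i)⟩
    intro i hi
    obtain rfl : i = 0 := by omega
    exact ⟨bot_le, by simp [hd0]⟩
  | succ c ih =>
    obtain ⟨W, hW, hW'⟩ := ih fun i hi => h i (by omega)
    obtain ⟨S, hS1, hS2, hS3⟩ := Submodule.exists_finrank_eq
      ((hW c le_rfl).1.trans (hF (Nat.le_succ c))) (k := d (c + 1))
      ((hW c le_rfl).2.trans_le (hd (Nat.le_succ c))) (h (c + 1) le_rfl)
    refine ⟨Function.update W (c + 1) S, ?_, ?_⟩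
    · intro i hi
      rcases hi.lt_or_eq with hi | rfl
      · rw [Function.update_of_ne hi.ne]
        exact hW i (by omega)
      · rw [Function.update_self]
        exact ⟨hS2, hS3⟩
    · intro i hi
      rw [Function.update_of_ne hi.ne]
      rcases Nat.lt_succ_iff_lt_or_eq.mp hi with hi | rfl
      · rw [Function.update_of_ne (by omega)]
        exact hW' i hi
      · rw [Function.update_self]
        exact hS1

theorem flagInter_mono {N : ℕ} (X : Matrix (Fin N) (Fin N) ℝ) : Monotone (flagInter X) :=
  fun _ _ h => inf_le_inf_left _ (range_D_mono N h)

/-- Orthogonal projections onto nested subspaces of the right dimensions define a point of the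
Bott–Samelson set. -/
theorem ofBlocks_mem (h : IsStaircase n lam c a b)
    {Y : ℕ → Matrix (Fin (m + n)) (Fin (m + n)) ℝ} (hY : ∀ i ≤ c, (Y i).IsOrthProj)
    (hfr : ∀ i ≤ c, Module.finrank ℝ (LinearMap.range (toLin' (Y i))) = mIdx a i)
    (hD : ∀ i ≤ c, LinearMap.range (toLin' (Y i)) ≤
      LinearMap.range (toLin' (D (m + n) (dIdx a b i))))
    (hYY : ∀ i < c, LinearMap.range (toLin' (Y i)) ≤ LinearMap.range (toLin' (Y (i + 1)))) :
    ofBlocks c Y ∈ bottSamelson m n c a b := by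
  rw [mem_bottSamelson_iff h]
  intro i hi
  rw [block_ofBlocks h.c_pos _ hi]
  refine ⟨hY _ hi, (hY _ hi).trace_eq_iff.mpr (hfr _ hi), ?_, ?_⟩
  · rw [← (D_isOrthProj _ _).mul_eq_comm (hY _ hi), (D_isOrthProj _ _).mul_eq_iff (hY _ hi)]
    exact hD _ hi
  · cases i with
    | zero => rw [block_zero, Matrix.mul_zero]
    | succ i =>
      rw [block_ofBlocks h.c_pos _ (by omega), (hY _ hi).mul_eq_iff (hY _ (by omega))]
      exact hYY _ hi

/-- The Schubert variety is the projection of the Bott–Samelson set. -/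
theorem mem_schubertVariety_iff_exists (h : IsStaircase n lam c a b)
    (x : Fin (m + n) × Fin (m + n) → ℝ) :
    x ∈ schubertVariety n lam ↔
      ∃ y ∈ bottSamelson m n c a b, (fun s => y (Sum.inl s)) = x := by
  rw [mem_schubertVariety_iff h]
  constructor
  · rintro ⟨h1, h2, h3⟩
    obtain ⟨W, hW, hW'⟩ := exists_nested (mIdx_zero a) (mIdx_mono a)
      ((flagInter_mono (toMatrix x)).comp (dIdx_mono a b)) h3
    have hex : ∀ i, ∃ Q : Matrix (Fin (m + n)) (Fin (m + n)) ℝ, Q.IsOrthProj ∧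
        LinearMap.range (toLin' Q) = W i := fun i => by
      obtain ⟨C, hC, hC'⟩ := Submodule.exists_orthonormal_matrix (W i) rfl
      exact ⟨_, IsOrthProj.of_mul_transpose hC, hC'⟩
    choose Y hY hYW using hex
    refine ⟨ofBlocks c Y, ofBlocks_mem h (fun i _ => hY i) (fun i hi => ?_) (fun i hi => ?_)
      (fun i hi => ?_), ?_⟩
    · rw [hYW, (hW i hi).2]
    · rw [hYW]
      exact (hW i hi).1.trans inf_le_right
    · rw [hYW, hYW]
      exact hW' i hi
    -- The last subspace chosen lies in im X and has its dimension m.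
    · have hc : Y c = toMatrix x := by
        apply (hY c).eq_of_range_eq h1
        rw [hYW]
        apply Submodule.eq_of_le_of_finrank_eq ((hW c le_rfl).1.trans inf_le_left)
        rw [(hW c le_rfl).2, h.mIdx_eq, h1.trace_eq_iff.mp h2]
      ext s
      exact congrFun (congrFun hc s.1) s.2
  · rintro ⟨y, hy, rfl⟩
    rw [toMatrix_inl h]
    have h1 := block_isOrthProj h hy le_rfl
    refine ⟨h1.1, by rw [h1.2, h.mIdx_eq], fun i hi => ?_⟩
    have h2 := block_isOrthProj h hy hi
    rw [← h2.1.trace_eq_iff.mp h2.2]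
    exact Submodule.finrank_mono (range_block_le h hy hi)

end Schubert

end

/-! ### The open cell and the lower bound on dim σ. -/

section

open Matrix

namespace Matrix

variable {n J : Type*} [Fintype n] [Fintype J] [DecidableEq J]

/-- BᵀBw = 0 forces |Bw|² = 0, and the rows selected by f then read w = 0. -/
theorem gramDet_ne_zero_of_submatrix_eq_one {B : Matrix n J ℝ} {f : J → n}
    (hf : B.submatrix f id = 1) : B.gramDet ≠ 0 := by
  intro h
  obtain ⟨w, hw, hw'⟩ := exists_mulVec_eq_zero_iff.mpr h
  apply hw
  have h1 : B *ᵥ w = 0 := by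
    rw [← dotProduct_self_eq_zero, dotProduct_mulVec, vecMul_mulVec, ← dotProduct_mulVec, hw', dotProduct_zero]
  ext j
  have h2 := congrFun h1 (f j)
  rw [← one_mulVec w, ← hf]
  exact h2

theorem spanProj_submatrix {B : Matrix n J ℝ} {f : J → n} (hf : B.submatrix f id = 1) :
    B.spanProj.submatrix id f = B * (Bᵀ * B)⁻¹ ∧ B.spanProj.submatrix f f = (Bᵀ * B)⁻¹ := by
  have h1 : Bᵀ.submatrix id f = 1 := by rw [← transpose_submatrix, hf, transpose_one]
  constructor
  · rw [spanProj_eq, submatrix_mul _ _ id id f Function.bijective_id, h1, Matrix.mul_one]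
    rfl
  · rw [spanProj_eq, submatrix_mul _ _ f id f Function.bijective_id, h1, Matrix.mul_one,
      submatrix_mul _ _ f id id Function.bijective_id, hf, Matrix.one_mul]
    rfl

theorem det_spanProj_submatrix_ne_zero {B : Matrix n J ℝ} {f : J → n}
    (hf : B.submatrix f id = 1) : (B.spanProj.submatrix f f).det ≠ 0 := by
  rw [(spanProj_submatrix hf).2, det_nonsing_inv, Ring.inverse_eq_inv']
  exact inv_ne_zero (gramDet_ne_zero_of_submatrix_eq_one hf)

/-- An echelon frame is recovered from its projection P as B = P_{·f} (P_{ff})⁻¹; the adjugate makes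
this a quotient of polynomials in the entries of P. -/
theorem spanProj_submatrix_mul_adjugate {B : Matrix n J ℝ} {f : J → n}
    (hf : B.submatrix f id = 1) :
    B.spanProj.submatrix id f * (B.spanProj.submatrix f f).adjugate =
      (B.spanProj.submatrix f f).det • B := by
  rw [(spanProj_submatrix hf).1, ← (spanProj_submatrix hf).2, Matrix.mul_assoc, mul_adjugate,
    Matrix.mul_smul, Matrix.mul_one]

end Matrix

namespace Schubert

open RealAlg

variable {m n c : ℕ} {lam : Fin m → ℕ} {a b : ℕ → ℕ}

/-- The parameters of the open cell of a Schubert variety. -/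
abbrev CellIdx (c : ℕ) (a b : ℕ → ℕ) :=
  Σ i : Fin c, (Σ l : Fin (i + 1), Fin (b l)) × Fin (a (i + 1))

theorem card_cellIdx : Fintype.card (CellIdx c a b) = bsDim c a b := by
  simp only [Fintype.card_sigma, Fintype.card_prod, Fintype.card_fin, bsDim]
  refine Finset.sum_congr rfl fun i _ => ?_
  rw [Fin.sum_univ_eq_sum_range b]

theorem eq_of_dIdx_le {i j p : ℕ} (hi : dIdx a b i ≤ p) (hi' : p < dIdx a b (i + 1))
    (hj : dIdx a b j ≤ p) (hj' : p < dIdx a b (j + 1)) : i = j := by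
  by_contra hne
  rcases Nat.lt_or_gt_of_ne hne with h | h
  · have := dIdx_mono a b (Nat.succ_le_of_lt h)
    simp only [Nat.succ_eq_add_one] at this
    omega
  · have := dIdx_mono a b (Nat.succ_le_of_lt h)
    simp only [Nat.succ_eq_add_one] at this
    omega

/-- The pivot row of a column of a frame in the open cell. -/
def pivot (b : ℕ → ℕ) (j : ColIdx c a) : ℕ := dIdx a b j.1 + b j.1 + j.2

theorem le_pivot (j : ColIdx c a) : dIdx a b j.1 ≤ pivot b j := by
  rw [pivot]
  omega

theorem pivot_lt (j : ColIdx c a) : pivot b j < dIdx a b (j.1 + 1) := by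
  rw [pivot, dIdx_succ]
  have := j.2.2
  omega

theorem pivot_injective : Function.Injective (pivot (c := c) (a := a) b) := by
  rintro ⟨i, r⟩ ⟨j, s⟩ h
  have hi := le_pivot (b := b) ⟨i, r⟩
  have hi' := pivot_lt (b := b) ⟨i, r⟩
  rw [h] at hi hi'
  obtain rfl : i = j := Fin.ext (eq_of_dIdx_le hi hi' (le_pivot ⟨j, s⟩) (pivot_lt ⟨j, s⟩))
  simp only [pivot] at h
  obtain rfl : r = s := Fin.ext (by omega)
  rfl

theorem pivot_ne (j : ColIdx c a) {l s : ℕ} (hs : s < b l) : pivot b j ≠ dIdx a b l + s := by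
  intro h
  have h1 := le_pivot (b := b) j
  have h2 := pivot_lt (b := b) j
  rw [h] at h1 h2
  have h3 := eq_of_dIdx_le h1 h2 (Nat.le_add_right _ _) (by rw [dIdx_succ]; omega)
  rw [pivot, ← h3] at h
  rw [← h3] at hs
  omega

/-- The frame with given entries in the rows that are not pivots. -/
def cellFrame {R : Type*} [CommRing R] (N : ℕ) (t : CellIdx c a b → R) :
    Matrix (Fin N) (ColIdx c a) R :=
  -- Rows d_l to d_{l+1} - 1 split into b_l free rows followed by a_{l+1} pivot rows. A column of
  -- level i is free in the free rows with l ≤ i, that is, in b_0 + … + b_i entries.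
  Matrix.of fun p j => (if (p : ℕ) = pivot b j then 1 else 0) +
    ∑ k : Σ l : Fin (j.1 + 1), Fin (b l),
      if (p : ℕ) = dIdx a b k.1 + k.2 then t ⟨j.1, k, j.2⟩ else 0

theorem cellFrame_map {R S : Type*} [CommRing R] [CommRing S] (N : ℕ) (t : CellIdx c a b → R)
    (f : R →+* S) : (cellFrame N t).map f = cellFrame N fun s => f (t s) := by
  ext p j
  simp only [cellFrame, map_apply, of_apply, map_add, map_sum, apply_ite f, map_one, map_zero]

theorem cellFrame_pivot {N : ℕ} (t : CellIdx c a b → ℝ) (p : Fin N) (i j : ColIdx c a)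
    (hp : (p : ℕ) = pivot b i) : cellFrame N t p j = if i = j then 1 else 0 := by
  rw [cellFrame, of_apply, Finset.sum_eq_zero, add_zero]
  · simp only [hp, pivot_injective.eq_iff]
  · intro k _
    rw [if_neg]
    rw [hp]
    exact pivot_ne i k.2.2

theorem cellFrame_entry {N : ℕ} (t : CellIdx c a b → ℝ) (p : Fin N) (s : CellIdx c a b)
    (hp : (p : ℕ) = dIdx a b s.2.1.1 + s.2.1.2) : cellFrame N t p ⟨s.1, s.2.2⟩ = t s := by
  obtain ⟨i, ⟨l, q⟩, r⟩ := s
  simp only at hp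
  rw [cellFrame, of_apply, if_neg, zero_add, Finset.sum_eq_single ⟨l, q⟩]
  · rw [if_pos hp]
  · rintro ⟨l', q'⟩ - hne
    rw [if_neg]
    intro h
    apply hne
    simp only at h
    have hl := eq_of_dIdx_le (a := a) (b := b) (p := p) (i := l) (j := l') (by omega)
      (by rw [dIdx_succ]; have := q.2; omega) (by omega) (by rw [dIdx_succ]; have := q'.2; omega)
    obtain rfl : l = l' := Fin.ext hl
    obtain rfl : q = q' := Fin.ext (by omega)
    rfl
  · simp
  · rw [hp]
    exact (pivot_ne _ q.2).symm

theorem isAdapted_cellFrame {N : ℕ} (t : CellIdx c a b → ℝ) : IsAdapted b (cellFrame N t) := by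
  intro p j hp
  rw [cellFrame, of_apply, if_neg, zero_add, Finset.sum_eq_zero]
  · intro k _
    rw [if_neg]
    intro h
    have h1 := dIdx_mono a b (show (k.1 : ℕ) + 1 ≤ j.1 + 1 by omega)
    have h2 := k.2.2
    rw [dIdx_succ] at h1
    omega
  · have := pivot_lt (b := b) j
    omega

/-- The pivot row as an index of a row. -/
def pivotRow (h : IsStaircase n lam c a b) (j : ColIdx c a) : Fin (m + n) :=
  ⟨pivot b j, (pivot_lt j).trans_le (h.dIdx_le j.1.2)⟩

theorem lowCols_cellFrame_submatrix (h : IsStaircase n lam c a b) (t : CellIdx c a b → ℝ) (i : ℕ) :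
    (lowCols (cellFrame (m + n) t) i).submatrix
      (fun j : {j : ColIdx c a // (j.1 : ℕ) < i} => pivotRow h j.1) id = 1 := by
  ext j j'
  rw [submatrix_apply, lowCols, submatrix_apply, one_apply]
  simp only [id, Subtype.ext_iff]
  exact cellFrame_pivot t _ _ _ rfl

/-- A vector Bw has w as its pivot coordinates. In ℝ^{d_i} the pivots of level at least i vanish,
which leaves m_i coordinates. -/
theorem finrank_flagInter_cellFrame_le (h : IsStaircase n lam c a b) (t : CellIdx c a b → ℝ)
    {i : ℕ} (hi : i ≤ c) : Module.finrank ℝ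
      (flagInter (lowCols (cellFrame (m + n) t) c).spanProj (dIdx a b i)) ≤ mIdx a i := by
  let f : (Fin (m + n) → ℝ) →ₗ[ℝ] ({j : ColIdx c a // (j.1 : ℕ) < i} → ℝ) :=
    LinearMap.funLeft ℝ ℝ fun j => pivotRow h j.1
  have hB := lowCols_cellFrame_submatrix h t c
  rw [← card_colIdx_lt hi, ← Module.finrank_fintype_fun_eq_card ℝ]
  refine LinearMap.finrank_le_finrank_of_injective
    (f := f.comp (flagInter (lowCols (cellFrame (m + n) t) c).spanProj (dIdx a b i)).subtype) ?_
  rw [injective_iff_map_eq_zero]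
  rintro ⟨v, hv12⟩ hv
  obtain ⟨hv1, hv2⟩ := Submodule.mem_inf.mp hv12
  rw [(D_isOrthProj _ _).mem_range_iff, D_mulVec_eq_iff] at hv2
  rw [(spanProj_isOrthProj (gramDet_ne_zero_of_submatrix_eq_one hB)).mem_range_iff, spanProj_eq,
    Matrix.mul_assoc, ← mulVec_mulVec] at hv1
  set w := (((lowCols (cellFrame (m + n) t) c)ᵀ * lowCols (cellFrame (m + n) t) c)⁻¹ *
    (lowCols (cellFrame (m + n) t) c)ᵀ) *ᵥ v
  have hw : ∀ j : {j : ColIdx c a // (j.1 : ℕ) < c}, w j = v (pivotRow h j.1) := fun j => by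
    rw [← hv1]
    conv_lhs => rw [← one_mulVec w, ← hB]
    rfl
  have hw0 : w = 0 := by
    ext j
    rw [hw]
    rcases Nat.lt_or_ge j.1.1 i with hj | hj
    · exact congrFun hv ⟨j.1, hj⟩
    · exact hv2 _ ((dIdx_mono a b hj).trans (le_pivot j.1))
  ext1
  rw [hw0, mulVec_zero] at hv1
  exact hv1.symm

theorem gramDet_lowCols_cellFrame (h : IsStaircase n lam c a b) (t : CellIdx c a b → ℝ) (i : ℕ) :
    (lowCols (cellFrame (m + n) t) i).gramDet ≠ 0 :=
  gramDet_ne_zero_of_submatrix_eq_one (lowCols_cellFrame_submatrix h t i)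

theorem exists_finrank_flagInter_eq (h : IsStaircase n lam c a b) :
    ∃ x ∈ schubertVariety n lam, ∀ i ≤ c,
      Module.finrank ℝ (flagInter (toMatrix x) (dIdx a b i)) = mIdx a i := by
  -- With all parameters zero the columns are the basis vectors at the pivots.
  let y : Coord (m + n) c → ℝ :=
    ofBlocks c fun i => (lowCols (cellFrame (m + n) fun _ : CellIdx c a b => 0) i).spanProj
  have hx : (fun s => y (Sum.inl s)) ∈ schubertVariety n lam :=
    (mem_schubertVariety_iff_exists h _).mpr ⟨y, ofBlocks_spanProj_mem h (isAdapted_cellFrame _)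
      fun i _ => gramDet_lowCols_cellFrame h _ _, rfl⟩
  refine ⟨_, hx, fun i hi => le_antisymm ?_ (((mem_schubertVariety_iff h _).mp hx).2.2 i hi)⟩
  exact finrank_flagInter_cellFrame_le h _ hi

theorem bsDim_le_dim_schubertVariety (h : IsStaircase n lam c a b) :
    (bsDim c a b : WithBot ℕ∞) ≤ dim (schubertVariety n lam) := by
  let B := cellFrame (m + n) fun s : CellIdx c a b => (MvPolynomial.X s : MvPolynomial _ ℝ)
  have hB : ∀ t, B.map (MvPolynomial.eval t) = cellFrame (m + n) t := fun t => by
    rw [cellFrame_map]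
    simp
  have hdet : ∀ t, MvPolynomial.eval t (frameDenom B) ≠ 0 := fun t => by
    rw [eval_frameDenom_ne_zero, hB]
    exact fun i _ => gramDet_lowCols_cellFrame h t _
  have hq : frameDenom B ≠ 0 := fun h0 => hdet 0 (by rw [h0, map_zero])
  have hpt : ∀ t, (fun s => ofBlocks c (fun i => (lowCols (cellFrame (m + n) t) i).spanProj)
      (Sum.inl s)) = paramPoint (frameDenom B) (fun s => frameNum B (Sum.inl s)) t := fun t => by
    rw [← hB, ← paramPoint_frame h.c_pos B (hdet t)]
    rfl
  rw [← card_cellIdx]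
  refine card_le_dim hq (fun s => frameNum B (Sum.inl s)) (fun t _ => ?_) fun s => ?_
  · rw [← hpt, mem_schubertVariety_iff_exists h]
    exact ⟨_, ofBlocks_spanProj_mem h (isAdapted_cellFrame t)
      fun i _ => gramDet_lowCols_cellFrame h t _, rfl⟩
  · let f : {j : ColIdx c a // (j.1 : ℕ) < c} → Fin (m + n) := fun j => pivotRow h j.1
    have hs : dIdx a b s.2.1.1 + s.2.1.2 < m + n := by
      have h1 := h.dIdx_le (k := s.2.1.1 + 1) (by omega)
      have h2 := s.2.1.2.2
      rw [dIdx_succ] at h1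
      omega
    -- The parameter s is the entry of the frame in its free row; Cramer's rule on the pivot minor
    -- of X expresses it with that minor as denominator.
    refine ⟨((genMatrix ℝ (m + n)).submatrix id f *
      ((genMatrix ℝ (m + n)).submatrix f f).adjugate) ⟨_, hs⟩ ⟨⟨s.1, s.2.2⟩, s.1.2⟩,
      ((genMatrix ℝ (m + n)).submatrix f f).det, fun t _ => ?_⟩
    have hf := lowCols_cellFrame_submatrix h t c
    have hX : (genMatrix ℝ (m + n)).map (MvPolynomial.eval
        (paramPoint (frameDenom B) (fun s => frameNum B (Sum.inl s)) t)) =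
        (lowCols (cellFrame (m + n) t) c).spanProj := by
      rw [← hpt]
      ext
      simp [genMatrix, ofBlocks]
    generalize paramPoint (frameDenom B) (fun s => frameNum B (Sum.inl s)) t = x at hX
    have h1 : MvPolynomial.eval x ((genMatrix ℝ (m + n)).submatrix f f).det =
        ((lowCols (cellFrame (m + n) t) c).spanProj.submatrix f f).det := by
      rw [RingHom.map_det, RingHom.mapMatrix_apply, ← hX]
      rfl
    have h2 : ((genMatrix ℝ (m + n)).submatrix id f *
        ((genMatrix ℝ (m + n)).submatrix f f).adjugate).map (MvPolynomial.eval x) =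
        ((lowCols (cellFrame (m + n) t) c).spanProj.submatrix f f).det •
          lowCols (cellFrame (m + n) t) c := by
      rw [Matrix.map_mul, ← RingHom.mapMatrix_apply _ (adjugate _), RingHom.map_adjugate,
        ← spanProj_submatrix_mul_adjugate hf, ← hX]
      rfl
    rw [h1]
    refine ⟨det_spanProj_submatrix_ne_zero hf, ?_⟩
    have h3 := congrFun (congrFun h2 ⟨_, hs⟩) ⟨⟨s.1, s.2.2⟩, s.1.2⟩
    rw [← cellFrame_entry t ⟨_, hs⟩ s rfl]
    exact h3

end Schubert

end

/-! ### The rational inverse and the conclusion. -/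

open Matrix

namespace Schubert

open RealAlg

variable {m n c : ℕ} {lam : Fin m → ℕ} {a b : ℕ → ℕ}

/-- A polynomial whose nonvanishing locus in the Schubert variety consists of the subspaces in
general position with respect to the flag. -/
noncomputable def genericPoly (N c : ℕ) (a b : ℕ → ℕ) : MvPolynomial (Fin N × Fin N) ℝ :=
  ∏ i ∈ Finset.range (c + 1), (genInter ℝ N (dIdx a b i)).charpoly.coeff (mIdx a i)

/-- On σ each intersection has dimension at least m_i; it equals m_i exactly when the coefficient of
index m_i does not vanish. -/
theorem aeval_genericPoly_ne_zero_iff (h : IsStaircase n lam c a b)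
    {x : Fin (m + n) × Fin (m + n) → ℝ} (hx : x ∈ schubertVariety n lam) :
    MvPolynomial.aeval x (genericPoly (m + n) c a b) ≠ 0 ↔
      ∀ i ≤ c, Module.finrank ℝ (flagInter (toMatrix x) (dIdx a b i)) = mIdx a i := by
  obtain ⟨h1, -, h3⟩ := (mem_schubertVariety_iff h x).mp hx
  rw [genericPoly, map_prod, Finset.prod_ne_zero_iff]
  simp only [Finset.mem_range, Nat.lt_succ_iff, aeval_coeff_charpoly_genInter]
  refine forall₂_congr fun i hi => ⟨fun H => ?_, fun H => ?_⟩
  · by_contra hne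
    exact H ((le_finrank_flagInter_iff h1 _ (mIdx a i + 1)).mp
      (lt_of_le_of_ne (h3 i hi) (Ne.symm hne)) _ (Nat.lt_succ_self _))
  · rw [← ker_interMatrix_eq h1] at H
    exact (charpolyShift_spec (h1.interMatrix_symm (D_isOrthProj _ _)) H).1

/-- The orthogonal projection onto the intersection of the range of `X` with a member of the flag,
if this intersection has dimension `k`. -/
noncomputable def flagProj {N : ℕ} (X : Matrix (Fin N) (Fin N) ℝ) (d k : ℕ) :
    Matrix (Fin N) (Fin N) ℝ :=
  ((interMatrix X (D N d)).charpoly.coeff k)⁻¹ • (interMatrix X (D N d)).charpolyShift k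

theorem flagProj_spec {N : ℕ} {X : Matrix (Fin N) (Fin N) ℝ} (hX : X.IsOrthProj) {d k : ℕ}
    (h : Module.finrank ℝ (flagInter X d) = k) :
    (flagProj X d k).IsOrthProj ∧ LinearMap.range (toLin' (flagProj X d k)) = flagInter X d := by
  rw [← ker_interMatrix_eq hX] at h ⊢
  exact (charpolyShift_spec (hX.interMatrix_symm (D_isOrthProj _ _)) h).2

/-- The inverse of the projection from the Bott–Samelson set to the Schubert variety. -/
noncomputable def lift (c : ℕ) (a b : ℕ → ℕ) {N : ℕ} (x : Fin N × Fin N → ℝ) : Coord N c → ℝ :=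
  ofBlocks c fun i => flagProj (toMatrix x) (dIdx a b i) (mIdx a i)

theorem isRegularOn_lift :
    IsRegularOn (lift c a b) {x | x ∈ schubertVariety n lam ∧
      MvPolynomial.aeval x (genericPoly (m + n) c a b) ≠ 0} := by
  have key : ∀ i ≤ c, ∀ p r : Fin (m + n), ∃ f g : MvPolynomial (Fin (m + n) × Fin (m + n)) ℝ,
      ∀ x ∈ {x | x ∈ schubertVariety n lam ∧
        MvPolynomial.aeval x (genericPoly (m + n) c a b) ≠ 0}, MvPolynomial.eval x g ≠ 0 ∧
        flagProj (toMatrix x) (dIdx a b i) (mIdx a i) p r =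
          MvPolynomial.eval x f / MvPolynomial.eval x g := by
    intro i hi p r
    refine ⟨(genInter ℝ (m + n) (dIdx a b i)).charpolyShift (mIdx a i) p r,
      (genInter ℝ (m + n) (dIdx a b i)).charpoly.coeff (mIdx a i), ?_⟩
    rintro x ⟨-, hx⟩
    rw [genericPoly, map_prod, Finset.prod_ne_zero_iff] at hx
    have h1 := hx i (Finset.mem_range.mpr (Nat.lt_succ_of_le hi))
    have h2 := charpolyShift_map (genInter ℝ (m + n) (dIdx a b i)) (mIdx a i)
      (MvPolynomial.aeval (R := ℝ) x).toRingHom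
    have h3 : ((genInter ℝ (m + n) (dIdx a b i)).charpolyShift (mIdx a i)).map
        (MvPolynomial.aeval x) =
        (interMatrix (toMatrix x) (D (m + n) (dIdx a b i))).charpolyShift (mIdx a i) := by
      rw [← genInter_map (K := ℝ)]
      exact h2
    rw [← MvPolynomial.coe_aeval_eq_eval, RingHom.coe_coe]
    refine ⟨h1, ?_⟩
    rw [aeval_coeff_charpoly_genInter, flagProj, ← h3, Matrix.smul_apply, smul_eq_mul, map_apply,
      div_eq_inv_mul]
  rintro (s | ⟨i, s⟩)
  · exact key c le_rfl s.1 s.2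
  · exact key (i + 1) (by omega) s.1 s.2

section Lift

variable {x : Fin (m + n) × Fin (m + n) → ℝ}

theorem lift_mem (h : IsStaircase n lam c a b) (hx : x ∈ schubertVariety n lam)
    (hx' : ∀ i ≤ c, Module.finrank ℝ (flagInter (toMatrix x) (dIdx a b i)) = mIdx a i) :
    lift c a b x ∈ bottSamelson m n c a b := by
  have hX := ((mem_schubertVariety_iff h x).mp hx).1
  refine ofBlocks_mem h (fun i hi => (flagProj_spec hX (hx' i hi)).1) (fun i hi => ?_)
    (fun i hi => ?_) fun i hi => ?_
  · rw [(flagProj_spec hX (hx' i hi)).2, hx' i hi]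
  · rw [(flagProj_spec hX (hx' i hi)).2]
    exact inf_le_right
  · rw [(flagProj_spec hX (hx' i hi.le)).2, (flagProj_spec hX (hx' (i + 1) hi)).2]
    exact flagInter_mono _ (dIdx_mono a b (Nat.le_succ i))

theorem lift_inl (h : IsStaircase n lam c a b) (hx : x ∈ schubertVariety n lam)
    (hx' : ∀ i ≤ c, Module.finrank ℝ (flagInter (toMatrix x) (dIdx a b i)) = mIdx a i) :
    (fun s => lift c a b x (Sum.inl s)) = x := by
  have hX := ((mem_schubertVariety_iff h x).mp hx).1
  have h1 := flagProj_spec hX (hx' c le_rfl)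
  have h2 : flagProj (toMatrix x) (dIdx a b c) (mIdx a c) = toMatrix x := by
    apply h1.1.eq_of_range_eq hX
    rw [h1.2, flagInter, D_eq_one h.dIdx_eq.ge, toLin'_one, LinearMap.range_id, inf_top_eq]
  ext s
  exact congrFun (congrFun h2 s.1) s.2

/-- W_i ⊆ W_c ∩ ℝ^{d_i} always holds, and in general position the dimensions agree, so X determines
every Y_i. -/
theorem lift_comp_inl (h : IsStaircase n lam c a b) {y : Coord (m + n) c → ℝ}
    (hy : y ∈ bottSamelson m n c a b)
    (hy' : ∀ i ≤ c, Module.finrank ℝ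
      (flagInter (toMatrix fun s => y (Sum.inl s)) (dIdx a b i)) = mIdx a i) :
    lift c a b (fun s => y (Sum.inl s)) = y := by
  conv_rhs => rw [← ofBlocks_block h.c_pos y]
  refine ofBlocks_congr h.c_pos fun i hi => ?_
  rw [toMatrix_inl h] at hy' ⊢
  have h1 := flagProj_spec (block_isOrthProj h hy le_rfl).1 (hy' (i + 1) hi)
  have h2 := block_isOrthProj h hy (Nat.succ_le_of_lt hi)
  apply h1.1.eq_of_range_eq h2.1
  rw [h1.2]
  refine (Submodule.eq_of_le_of_finrank_eq (range_block_le h hy hi) ?_).symm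
  rw [h2.1.trace_eq_iff.mp h2.2, hy' (i + 1) hi]

end Lift

/-- The general-position loci in Z and σ are nonempty Zariski open subsets of irreducible sets,
hence dense. -/
theorem isBirationalOn_projection (h : IsStaircase n lam c a b) :
    IsBirationalOn (fun (y : Coord (m + n) c → ℝ) s => y (Sum.inl s)) (bottSamelson m n c a b)
      (schubertVariety n lam) := by
  have hproj := mem_schubertVariety_iff_exists h
  obtain ⟨x₀, hx₀, hx₀'⟩ := exists_finrank_flagInter_eq h
  have hZ := isPrime_vanishingIdeal_bottSamelson h ⟨_, lift_mem h hx₀ hx₀'⟩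
  have hσ := isPrime_vanishingIdeal_of_projection hproj hZ
  let e := genericPoly (m + n) c a b
  let T : Set (Fin (m + n) × Fin (m + n) → ℝ) := {x | ∀ _ : Unit, MvPolynomial.aeval x e = 0}
  let T' : Set (Coord (m + n) c → ℝ) :=
    {y | ∀ _ : Unit, MvPolynomial.aeval y (MvPolynomial.rename Sum.inl e) = 0}
  have hT : IsAlgebraicSet ℝ T := isAlgebraicSet_setOf_aeval_eq_zero _
  have hT' : IsAlgebraicSet ℝ T' := isAlgebraicSet_setOf_aeval_eq_zero _
  have hTmem : ∀ x, x ∉ T ↔ MvPolynomial.aeval x e ≠ 0 := fun x => by simp [T]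
  have hTT' : ∀ y : Coord (m + n) c → ℝ, y ∉ T' ↔ (fun s => y (Sum.inl s)) ∉ T := fun y => by
    rw [hTmem, Set.mem_ofPred_eq, forall_const, MvPolynomial.aeval_rename]
    rfl
  have hU : ∀ x ∈ schubertVariety n lam \ T, ∀ i ≤ c,
      Module.finrank ℝ (flagInter (toMatrix x) (dIdx a b i)) = mIdx a i := fun x hx =>
    (aeval_genericPoly_ne_zero_iff h hx.1).mp ((hTmem x).mp hx.2)
  have hx₀T : x₀ ∉ T := (hTmem x₀).mpr ((aeval_genericPoly_ne_zero_iff h hx₀).mpr hx₀')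
  have hreg : ∀ S : Set (Coord (m + n) c → ℝ), IsRegularOn (fun y s => y (Sum.inl s)) S :=
    fun S s => ⟨MvPolynomial.X (Sum.inl s), 1, fun y _ => by simp⟩
  have hmaps : Set.MapsTo (fun (y : Coord (m + n) c → ℝ) s => y (Sum.inl s))
      (bottSamelson m n c a b) (schubertVariety n lam) := fun y hy => (hproj _).mpr ⟨y, hy, rfl⟩
  have hlift : Set.MapsTo (lift c a b) (schubertVariety n lam \ T) (bottSamelson m n c a b \ T') :=
    fun x hx => ⟨lift_mem h hx.1 (hU x hx), by
      rw [hTT', lift_inl h hx.1 (hU x hx)]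
      exact hx.2⟩
  have hmapsU : Set.MapsTo (fun (y : Coord (m + n) c → ℝ) s => y (Sum.inl s))
      (bottSamelson m n c a b \ T') (schubertVariety n lam \ T) :=
    fun y hy => ⟨hmaps hy.1, (hTT' y).mp hy.2⟩
  refine ⟨hreg _, hmaps, bottSamelson m n c a b \ T', schubertVariety n lam \ T, ⟨T', hT', rfl⟩,
    isZariskiDenseIn_diff hZ hT' ⟨_, hlift ⟨hx₀, hx₀T⟩⟩, ⟨T, hT, rfl⟩,
    isZariskiDenseIn_diff hσ hT ⟨x₀, hx₀, hx₀T⟩, hreg _, hmapsU, lift c a b, ?_, hlift,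
    fun y hy => lift_comp_inl h hy.1 (hU _ (hmapsU hy)), fun x hx => lift_inl h hx.1 (hU x hx)⟩
  intro j
  obtain ⟨p, q, hpq⟩ := isRegularOn_lift j
  exact ⟨p, q, fun x hx => hpq x ⟨hx.1, (hTmem x).mp hx.2⟩⟩

end Schubert

open Schubert RealAlg

theorem lemma2p7 (m n : ℕ) (hm : 0 < m) (hn : 0 < n) (lam : Fin m → ℕ)
    (hlam : Schubert.IsPartition n lam) (c : ℕ) (a b : ℕ → ℕ)
    (hab : Schubert.IsStaircase n lam c a b) (hac : 0 < a c) (hb0 : 0 < b 0) :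
    RealAlg.IsDesingularization (Schubert.bottSamelson m n c a b)
      (Schubert.schubertVariety n lam) := by
  have hproj := mem_schubertVariety_iff_exists hab
  obtain ⟨x₀, hx₀, -⟩ := exists_finrank_flagInter_eq hab
  obtain ⟨y₀, hy₀, -⟩ := (hproj x₀).mp hx₀
  have hZ := isPrime_vanishingIdeal_bottSamelson hab ⟨y₀, hy₀⟩
  have hT : ∀ y ∈ bottSamelson m n c a b,
      Module.finrank ℝ (tangentSpace (bottSamelson m n c a b) y) ≤ bsDim c a b :=
    fun y hy => finrank_tangentSpace_bottSamelson_le hab hy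
  have h1 := bsDim_le_dim_schubertVariety hab
  have h2 := dim_le_of_projection hproj hZ
  -- This closes the cycle of inequalities, so both dimensions equal `bsDim`.
  have h3 : dim (bottSamelson m n c a b) ≤ bsDim c a b :=
    (dim_le_finrank_tangentSpace hZ hy₀).trans (by exact_mod_cast hT y₀ hy₀)
  exact ⟨isAlgebraicSet_schubertVariety, isAlgebraicSet_bottSamelson hab,
    le_antisymm (h3.trans h1) h2, isNonsingular_of_finrank_tangentSpace_le hZ (h1.trans h2) hT,
    isBirationalOn_projection hab⟩
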